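/- Theorem 4. Let $a\in\mathbb R$, $a\neq 0$, let $U\subset\mathbb R^2$ be a non-empty open set with coordinates $(x,y)$, and let $h,H:U\to\mathbb R$ be smooth positive functions satisfying $$(\ln H)_{xx}+(\ln H)_{yy}=-2a^2h^2+4a^2H^2\quad\text{on }U.$$ Put $g_\Sigma=h^2(dx^2+dy^2)$, $\omega_\Sigma=h^2\,dx\wedge dy$, $l_2=-\frac1{2a}(\ln H)_y$, $n_2=\frac1{2a}(\ln H)_x$. On the $4$-manifold $M=U\times\{(z,t)\in\mathbb R^2: z<0\}$ define $$\theta_3=\sinh 2az\,dt-(\cos 2at\cosh 2az\,H+\sinh 2az\,l_2)\,dx-(-\cosh 2az\sin 2at\,H+\sinh 2az\,n_2)\,dy,$$ $$\theta_4=dz-\sin 2at\,H\,dx-\cos 2at\,H\,dy,\qquad g=(\cosh az)^2g_\Sigma+\theta_3^2+\theta_4^2 .$$ Then $g$ is a Riemannian metric on $M$, and there are a Kähler structure $\bar J$ on $(M,g)$ with Kähler form $g(\bar J\cdot,\cdot)=\bar\Omega=(\cosh az)^2\omega_\Sigma+\theta_4\wedge\theta_3$ and a Hermitian structure $J$ on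 $(M,g)$ with Kähler form $g(J\cdot,\cdot)=\Omega=(\cosh az)^2\omega_\Sigma+\theta_3\wedge\theta_4$, such that: (i) $(M,g,\bar J)$ is a QCH Kähler surface with respect to the $\bar J$-invariant distribution $\mathcal D=\ker dx\cap\ker dy$: for a tangent vector $X$ with $g(X,X)=1$, the holomorphic curvature $R(X,\bar JX,\bar JX,X)$ depends only on the base point and on the length of the $g$-orthogonal projection of $X$ to $\mathcal D$; (ii) $J$ is opposite to $\bar J$, that is, $\Omega$ is anti-self-dual for $g$ and the orientation defined by $\bar J$; (iii) the Ricci tensor $\rho$ of $g$ is $J$-invariant, $\rho(JX,JY)=\rho(X,Y)$; (iv) $(M,g,J)$ is not locally conformally Kähler; (v) the Lee form of $(M,g,J)$, defined by $d\Omega=2\theta\wedge\Omega$, is $\theta=-\alpha\theta_4$ with $\alpha=-2a\tanh az$. -/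

import Mathlib

open scoped ContDiff Matrix

noncomputable section

namespace KahlerSurface

/-- `ℝ⁴`; its points are `(x, y, z, t)` and its tangent vectors are written in the frame
`∂/∂x, ∂/∂y, ∂/∂z, ∂/∂t`. -/
abbrev R4 : Type := Fin 4 → ℝ

/-- Two-forms on `ℝ⁴` at a point. -/
abbrev Alt2 : Type := R4 [⋀^Fin 2]→L[ℝ] ℝ

/-- Fields of bilinear forms. -/
abbrev BilinField : Type := R4 → R4 →L[ℝ] R4 →L[ℝ] ℝ

/-- Fields of endomorphisms of the tangent spaces. -/
abbrev EndField : Type := R4 → R4 →L[ℝ] R4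

/-! ### One-forms and two-forms -/

/-- The exterior product of two linear forms. -/
def wedge (α β : R4 →L[ℝ] ℝ) : Alt2 :=
  ContinuousMultilinearMap.alternatization
    ((ContinuousMultilinearMap.mkPiAlgebra ℝ (Fin 2) ℝ).compContinuousLinearMap ![α, β])

theorem wedge_apply (α β : R4 →L[ℝ] ℝ) (X Y : R4) :
    wedge α β ![X, Y] = α X * β Y - α Y * β X := by
  have hu : (Finset.univ : Finset (Equiv.Perm (Fin 2))) = {1, Equiv.swap 0 1} := by decide
  have hne : (1 : Equiv.Perm (Fin 2)) ≠ Equiv.swap 0 1 := by decide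
  simp [wedge, ContinuousMultilinearMap.alternatization_apply_apply, hu,
    Finset.sum_pair hne, Fin.prod_univ_two, sub_eq_add_neg]

/-- The coordinate one-forms `dx, dy, dz, dt` (for `i = 0, 1, 2, 3`). -/
def dcoord (i : Fin 4) : R4 →L[ℝ] ℝ := ContinuousLinearMap.proj i

/-- The symmetric square `α ⊗ α` of a linear form. -/
def sqForm (α : R4 →L[ℝ] ℝ) : R4 →L[ℝ] R4 →L[ℝ] ℝ := α.smulRight α

/-! ### Riemannian metrics and curvature on an open set `M` of `ℝ⁴` -/

/-- `g` is a (smooth) Riemannian metric on `M`. -/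
structure IsRiemannianMetric (M : Set R4) (g : BilinField) : Prop where
  smooth : ContDiffOn ℝ ∞ g M
  symm : ∀ p ∈ M, ∀ X Y, g p X Y = g p Y X
  pos : ∀ p ∈ M, ∀ X, X ≠ 0 → 0 < g p X X

/-- The Gram matrix of the metric in the coordinate frame. -/
def gram (g : BilinField) (p : R4) : Matrix (Fin 4) (Fin 4) ℝ :=
  Matrix.of fun i j => g p (Pi.single i 1) (Pi.single j 1)

/-- The Christoffel field `Γ(X, Y) = ∑ X^i Y^j Γ^k_ij ∂_k` of the Levi-Civita connection:
`∇_X Y = D_X Y + Γ(X, Y)`, that is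
`g(Γ(X, Y), Z) = ½ ((D_X g)(Y, Z) + (D_Y g)(X, Z) - (D_Z g)(X, Y))`. -/
def christoffel (g : BilinField) (p X Y : R4) : R4 :=
  (gram g p)⁻¹ *ᵥ fun l : Fin 4 =>
    (1 / 2 : ℝ) * (fderiv ℝ g p X Y (Pi.single l 1) + fderiv ℝ g p Y X (Pi.single l 1)
      - fderiv ℝ g p (Pi.single l 1) X Y)

/-- The curvature `R(X, Y)Z = ∇_X ∇_Y Z - ∇_Y ∇_X Z - ∇_[X,Y] Z` of the Levi-Civita
connection at `p`. -/
def riemann (g : BilinField) (p X Y Z : R4) : R4 :=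
  fderiv ℝ (fun q => christoffel g q Y Z) p X - fderiv ℝ (fun q => christoffel g q X Z) p Y
    + christoffel g p X (christoffel g p Y Z) - christoffel g p Y (christoffel g p X Z)

/-- The Ricci tensor `ρ(Y, Z) = tr (X ↦ R(X, Y)Z)`. -/
def ricci (g : BilinField) (p Y Z : R4) : ℝ :=
  ∑ i : Fin 4, riemann g p (Pi.single i 1) Y Z i

/-! ### Hermitian and Kähler structures -/

/-- The Nijenhuis tensor field
`N^J(X, Y) = [JX, JY] - J[JX, Y] - J[X, JY] - [X, Y]` of two vector fields. -/
def nijenhuis (J : EndField) (X Y : R4 → R4) (p : R4) : R4 :=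
  VectorField.lieBracket ℝ (fun q => J q (X q)) (fun q => J q (Y q)) p
    - J p (VectorField.lieBracket ℝ (fun q => J q (X q)) Y p)
    - J p (VectorField.lieBracket ℝ X (fun q => J q (Y q)) p)
    - VectorField.lieBracket ℝ X Y p

/-- `(M, g, J)` is a Hermitian manifold: `J` is a smooth `g`-orthogonal almost complex structure
whose Nijenhuis tensor vanishes. -/
structure IsHermitian (M : Set R4) (g : BilinField) (J : EndField) : Prop where
  metric : IsRiemannianMetric M g
  smooth : ContDiffOn ℝ ∞ J M
  sq : ∀ p ∈ M, ∀ X, J p (J p X) = -X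
  orthogonal : ∀ p ∈ M, ∀ X Y, g p (J p X) (J p Y) = g p X Y
  integrable : ∀ X Y : R4 → R4, ContDiffOn ℝ ∞ X M → ContDiffOn ℝ ∞ Y M →
    ∀ p ∈ M, nijenhuis J X Y p = 0

/-- `Ω` is the Kähler form of `(M, g, J)`: `Ω(X, Y) = g(JX, Y)`. -/
def IsKahlerForm (M : Set R4) (g : BilinField) (J : EndField) (Ω : R4 → Alt2) : Prop :=
  ∀ p ∈ M, ∀ X Y, Ω p ![X, Y] = g p (J p X) Y

/-- `(M, g, J)` is a Kähler manifold: it is Hermitian and its Kähler form is closed. -/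
def IsKahler (M : Set R4) (g : BilinField) (J : EndField) : Prop :=
  IsHermitian M g J ∧ ∃ Ω, IsKahlerForm M g J Ω ∧ ∀ p ∈ M, extDeriv Ω p = 0

/-- `(M, g, J)` is locally conformally Kähler: near each point of `M` some metric `e^f g`
conformal to `g` is Kähler with respect to `J`. -/
def IsLocallyConformallyKahler (M : Set R4) (g : BilinField) (J : EndField) : Prop :=
  ∀ p ∈ M, ∃ W : Set R4, IsOpen W ∧ p ∈ W ∧ W ⊆ M ∧
    ∃ f : R4 → ℝ, ContDiffOn ℝ ∞ f W ∧ IsKahler W (fun q => Real.exp (f q) • g q) J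

/-- `θ` is the Lee form of a Hermitian structure with Kähler form `Ω` on `M`, in the normalization
`dΩ = 2 θ ∧ Ω`. -/
def IsLeeForm (M : Set R4) (Ω : R4 → Alt2) (θ : R4 → R4 →L[ℝ] ℝ) : Prop :=
  ContDiffOn ℝ ∞ θ M ∧ ∀ p ∈ M, ∀ X Y Z,
    extDeriv Ω p ![X, Y, Z]
      = 2 * (θ p X * Ω p ![Y, Z] - θ p Y * Ω p ![X, Z] + θ p Z * Ω p ![X, Y])

/-- The Ricci tensor is `J`-invariant: `ρ(JX, JY) = ρ(X, Y)`. -/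
def RicciInvariant (M : Set R4) (g : BilinField) (J : EndField) : Prop :=
  ∀ p ∈ M, ∀ X Y, ricci g p (J p X) (J p Y) = ricci g p X Y

/-- `e` is an orthonormal basis for `g` at `p`. -/
def IsOrthonormalFrame (g : BilinField) (p : R4) (e : Fin 4 → R4) : Prop :=
  ∀ i j, g p (e i) (e j) = if i = j then 1 else 0

/-- `½ (ω ∧ ω)(e₀, e₁, e₂, e₃)` for the two-form `ω(X, Y) = g(JX, Y)`. Its sign says whether the
basis `e` is positive for the orientation defined by `J`. -/
def orientationValue (g : BilinField) (J : EndField) (p : R4) (e : Fin 4 → R4) : ℝ :=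
  g p (J p (e 0)) (e 1) * g p (J p (e 2)) (e 3) - g p (J p (e 0)) (e 2) * g p (J p (e 1)) (e 3)
    + g p (J p (e 0)) (e 3) * g p (J p (e 1)) (e 2)

/-- `J` is opposite to `J'`: its Kähler form `ω` is anti-self-dual for the orientation defined by
`J'`, that is, `ω(e₀, e₁) = -ω(e₂, e₃)` for every positive orthonormal basis `e`. -/
def IsOpposite (M : Set R4) (g : BilinField) (J' J : EndField) : Prop :=
  ∀ p ∈ M, ∀ e : Fin 4 → R4, IsOrthonormalFrame g p e → 0 < orientationValue g J' p e →
    g p (J p (e 0)) (e 1) = -g p (J p (e 2)) (e 3)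

/-! ### QCH Kähler surfaces -/

/-- `D` is a smooth distribution of rank two on `M`. -/
def IsPlaneDistribution (M : Set R4) (D : R4 → Submodule ℝ R4) : Prop :=
  ∀ p ∈ M, ∃ W : Set R4, IsOpen W ∧ p ∈ W ∧ W ⊆ M ∧ ∃ X Y : R4 → R4,
    ContDiffOn ℝ ∞ X W ∧ ContDiffOn ℝ ∞ Y W ∧
      ∀ q ∈ W, LinearIndependent ℝ ![X q, Y q] ∧ D q = Submodule.span ℝ {X q, Y q}

/-- `Z` is the orthogonal projection of `X` to the subspace `D` for the scalar product `g` at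
`p`. -/
def IsOrthogonalProjection (g : BilinField) (p : R4) (D : Submodule ℝ R4) (X Z : R4) : Prop :=
  Z ∈ D ∧ ∀ V ∈ D, g p (X - Z) V = 0

/-- `(M, g, J)` is a QCH Kähler surface with respect to `D`: it is Kähler, `D` is a `J`-invariant
distribution of rank two, and the holomorphic curvature `R(X, JX, JX, X) = g(R(X, JX)JX, X)` of a
unit vector `X` depends only on the point and on the norm of the projection of `X` to `D`. -/
structure IsQCH (M : Set R4) (g : BilinField) (J : EndField) (D : R4 → Submodule ℝ R4) :
    Prop where
  kahler : IsKahler M g J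
  distribution : IsPlaneDistribution M D
  invariant : ∀ p ∈ M, ∀ X ∈ D p, J p X ∈ D p
  curvature : ∃ φ : R4 → ℝ → ℝ, ∀ p ∈ M, ∀ X Z, g p X X = 1 →
    IsOrthogonalProjection g p (D p) X Z →
      g p (riemann g p X (J p X) (J p X)) X = φ p (Real.sqrt (g p Z Z))

/-! ### The explicit data -/

/-- Partial derivative in the first variable of the plane. -/
def partialX (F : ℝ × ℝ → ℝ) (q : ℝ × ℝ) : ℝ := fderiv ℝ F q (1, 0)

/-- Partial derivative in the second variable of the plane. -/
def partialY (F : ℝ × ℝ → ℝ) (q : ℝ × ℝ) : ℝ := fderiv ℝ F q (0, 1)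

/-- The flat Laplacian `F_xx + F_yy`. -/
def laplacian2 (F : ℝ × ℝ → ℝ) (q : ℝ × ℝ) : ℝ :=
  partialX (partialX F) q + partialY (partialY F) q

/-- `M = U × {(z, t) : z < 0}`. -/
def domain (U : Set (ℝ × ℝ)) : Set R4 := {p | (p 0, p 1) ∈ U ∧ p 2 < 0}

/-- `l₂ = -(1 / 2a) (ln H)_y`. -/
def l2 (a : ℝ) (H : ℝ × ℝ → ℝ) (q : ℝ × ℝ) : ℝ :=
  -(1 / (2 * a)) * partialY (fun r => Real.log (H r)) q

/-- `n₂ = (1 / 2a) (ln H)_x`. -/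
def n2 (a : ℝ) (H : ℝ × ℝ → ℝ) (q : ℝ × ℝ) : ℝ :=
  1 / (2 * a) * partialX (fun r => Real.log (H r)) q

/-- `θ₃ = sinh 2az dt - (cos 2at cosh 2az H + sinh 2az l₂) dx
  - (-cosh 2az sin 2at H + sinh 2az n₂) dy`. -/
def theta3 (a : ℝ) (H : ℝ × ℝ → ℝ) (p : R4) : R4 →L[ℝ] ℝ :=
  Real.sinh (2 * a * p 2) • dcoord 3
    - (Real.cos (2 * a * p 3) * Real.cosh (2 * a * p 2) * H (p 0, p 1)
        + Real.sinh (2 * a * p 2) * l2 a H (p 0, p 1)) • dcoord 0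
    - (-(Real.cosh (2 * a * p 2) * Real.sin (2 * a * p 3) * H (p 0, p 1))
        + Real.sinh (2 * a * p 2) * n2 a H (p 0, p 1)) • dcoord 1

/-- `θ₄ = dz - sin 2at H dx - cos 2at H dy`. -/
def theta4 (a : ℝ) (H : ℝ × ℝ → ℝ) (p : R4) : R4 →L[ℝ] ℝ :=
  dcoord 2 - (Real.sin (2 * a * p 3) * H (p 0, p 1)) • dcoord 0
    - (Real.cos (2 * a * p 3) * H (p 0, p 1)) • dcoord 1

/-- The pull-back to `ℝ⁴` of the metric `g_Σ = h² (dx² + dy²)`. -/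
def gSigma (h : ℝ × ℝ → ℝ) (p : R4) : R4 →L[ℝ] R4 →L[ℝ] ℝ :=
  h (p 0, p 1) ^ 2 • (sqForm (dcoord 0) + sqForm (dcoord 1))

/-- The pull-back to `ℝ⁴` of the area form `ω_Σ = h² dx ∧ dy`. -/
def omegaSigma (h : ℝ × ℝ → ℝ) (p : R4) : Alt2 :=
  h (p 0, p 1) ^ 2 • wedge (dcoord 0) (dcoord 1)

/-- `g = (cosh az)² g_Σ + θ₃² + θ₄²`. -/
def metric (a : ℝ) (h H : ℝ × ℝ → ℝ) : BilinField := fun p =>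
  Real.cosh (a * p 2) ^ 2 • gSigma h p + sqForm (theta3 a H p) + sqForm (theta4 a H p)

/-- `Ω̄ = (cosh az)² ω_Σ + θ₄ ∧ θ₃`. -/
def omegaBar (a : ℝ) (h H : ℝ × ℝ → ℝ) (p : R4) : Alt2 :=
  Real.cosh (a * p 2) ^ 2 • omegaSigma h p + wedge (theta4 a H p) (theta3 a H p)

/-- `Ω = (cosh az)² ω_Σ + θ₃ ∧ θ₄`. -/
def omega (a : ℝ) (h H : ℝ × ℝ → ℝ) (p : R4) : Alt2 :=
  Real.cosh (a * p 2) ^ 2 • omegaSigma h p + wedge (theta3 a H p) (theta4 a H p)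

/-- `α = -2a tanh az`. -/
def alpha (a : ℝ) (p : R4) : ℝ := -2 * a * Real.tanh (a * p 2)

/-- The distribution `𝒟 = ker dx ∩ ker dy`, spanned by `∂/∂z` and `∂/∂t`. -/
def vertical (_ : R4) : Submodule ℝ R4 :=
  LinearMap.ker (dcoord 0).toLinearMap ⊓ LinearMap.ker (dcoord 1).toLinearMap

end KahlerSurface

end

/-! The proof is Cartan's method of moving frames. With θ₁ = h cosh az dx and θ₂ = h cosh az dy, the
forms θ₁, θ₂, θ₃, θ₄ are an orthonormal coframe of g; it is nondegenerate because sinh 2az ≠ 0 for z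
< 0.

The computation rests on three auxiliary forms. P + iQ = H e^{2iat}(dx + i dy) and A = dt - l₂ dx -
n₂ dy satisfy d(P + iQ) = 2ia A ∧ (P + iQ), which is what l₂ and n₂ are chosen for. The differential
equation for H says exactly that dA = (a h² - 2a H²) dx ∧ dy. Since θ₃ = sinh 2az A - cosh 2az P and
B = cosh 2az A - sinh 2az P form a hyperbolic rotation of the pair A, P, these give dθ₃ = 2a θ₄ ∧ B
+ 2a tanh az θ₁ ∧ θ₂ and dθ₄ = -2a θ₃ ∧ B (`extOne_theta3_eq`, `extOne_theta4_eq`).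

All the claims follow from these equations. Modulo terms of type (1,1), d(θ₃ ± iθ₄) is a multiple of
θ₃ ± iθ₄, so both J̄ and J are integrable; wedge products give dΩ̄ = 0 and dΩ = 4a tanh az θ₄ ∧ Ω.
The Levi-Civita connection form (`isConnectionForm`) is skew and commutes with J̄, and its curvature
(`curvatureForm_connection`) is a fixed algebraic model in a and one function k. From the model, the
Ricci tensor is a multiple of g on 𝒟 and on its orthogonal complement, and the holomorphic curvature
is a polynomial in the squared norms of the two components of a vector. Finally, a locally
conformally Kähler structure has closed Lee form, whereas here dθ ≠ 0. -/

noncomputable section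

namespace KahlerSurface

/-! ### Moving frames: connection, curvature and integrability in an orthonormal coframe. -/

section Frames

variable {M : Set R4} {g : BilinField} {T : R4 → R4 →L[ℝ] R4}

/-- The exterior derivative of a vector-valued one-form, evaluated on constant fields. -/
def extOne {F : Type*} [NormedAddCommGroup F] [NormedSpace ℝ F] (α : R4 → R4 →L[ℝ] F)
    (p X Y : R4) : F :=
  fderiv ℝ α p X Y - fderiv ℝ α p Y X

theorem dotProduct_four (u v : R4) :
    u ⬝ᵥ v = u 0 * v 0 + u 1 * v 1 + u 2 * v 2 + u 3 * v 3 := by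
  simp [dotProduct, Fin.sum_univ_four]

theorem contDiffAt_of_mem {E F : Type*} [NormedAddCommGroup E] [NormedSpace ℝ E]
    [NormedAddCommGroup F] [NormedSpace ℝ F] {f : E → F} {s : Set E}
    (hs : IsOpen s) (hf : ContDiffOn ℝ ∞ f s) {p : E} (hp : p ∈ s) : ContDiffAt ℝ ∞ f p :=
  hf.contDiffAt (hs.mem_nhds hp)

theorem differentiableAt_of_mem {E F : Type*} [NormedAddCommGroup E] [NormedSpace ℝ E]
    [NormedAddCommGroup F] [NormedSpace ℝ F] {f : E → F} {s : Set E}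
    (hs : IsOpen s) (hf : ContDiffOn ℝ ∞ f s) {p : E} (hp : p ∈ s) : DifferentiableAt ℝ f p :=
  (contDiffAt_of_mem hs hf hp).differentiableAt (by simp)

theorem fderiv_clm_apply_const {E F G : Type*} [NormedAddCommGroup E] [NormedSpace ℝ E]
    [NormedAddCommGroup F] [NormedSpace ℝ F] [NormedAddCommGroup G] [NormedSpace ℝ G]
    {α : E → F →L[ℝ] G} {p : E} (hα : DifferentiableAt ℝ α p) (X : E) (Y : F) :
    fderiv ℝ (fun q => α q Y) p X = fderiv ℝ α p X Y := by
  rw [fderiv_clm_apply hα (differentiableAt_const Y)]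
  simp

/-- The derivative of a metric given by an orthonormal coframe. -/
theorem fderiv_metric_of_coframe (hM : IsOpen M) (hT : ContDiffOn ℝ ∞ T M)
    (hgs : ContDiffOn ℝ ∞ g M) (hg : ∀ p ∈ M, ∀ X Y, g p X Y = T p X ⬝ᵥ T p Y)
    {p : R4} (hp : p ∈ M) (X Y Z : R4) :
    fderiv ℝ g p X Y Z = fderiv ℝ T p X Y ⬝ᵥ T p Z + T p Y ⬝ᵥ fderiv ℝ T p X Z := by
  have hgd := differentiableAt_of_mem hM hgs hp
  have hTd := differentiableAt_of_mem hM hT hp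
  have h1 : fderiv ℝ g p X Y Z = fderiv ℝ (fun q => g q Y Z) p X := by
    rw [fderiv_clm_apply_const (hgd.clm_apply (differentiableAt_const Y)),
      fderiv_clm_apply_const hgd]
  have h2 : (fun q => g q Y Z) =ᶠ[nhds p] fun q => ∑ i, T q Y i * T q Z i := by
    filter_upwards [hM.mem_nhds hp] with q hq
    exact hg q hq Y Z
  have hc : ∀ (V : R4) (i : Fin 4),
      HasFDerivAt (fun q => T q V i) ((ContinuousLinearMap.proj i).comp
        ((ContinuousLinearMap.apply ℝ R4 V).comp (fderiv ℝ T p))) p := fun V i =>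
    (ContinuousLinearMap.proj (R := ℝ) (φ := fun _ : Fin 4 => ℝ) i).hasFDerivAt.comp p
      ((ContinuousLinearMap.apply ℝ R4 V).hasFDerivAt.comp p hTd.hasFDerivAt)
  have h3 := HasFDerivAt.fun_sum (u := Finset.univ) fun i _ => (hc Y i).fun_mul (hc Z i)
  rw [h1, h2.fderiv_eq, h3.fderiv]
  simp only [dotProduct, Fin.sum_univ_four]
  simp
  ring

theorem gram_isUnit_det (hinv : ∀ p ∈ M, (T p).IsInvertible)
    (hg : ∀ p ∈ M, ∀ X Y, g p X Y = T p X ⬝ᵥ T p Y) {p : R4} (hp : p ∈ M) :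
    IsUnit (gram g p).det := by
  have h : gram g p = (LinearMap.toMatrix' (T p).toLinearMap)ᵀ
      * LinearMap.toMatrix' (T p).toLinearMap := by
    ext i j
    simp [gram, hg p hp, Matrix.mul_apply, dotProduct, LinearMap.toMatrix'_apply]
  have h2 : LinearMap.toMatrix' ((T p).inverse).toLinearMap
      * LinearMap.toMatrix' (T p).toLinearMap = 1 := by
    rw [← LinearMap.toMatrix'_comp]
    have : (T p).inverse.toLinearMap ∘ₗ (T p).toLinearMap = LinearMap.id := by
      ext1
      ext1
      simp [(hinv p hp).inverse_apply_self]
    rw [this, LinearMap.toMatrix'_id]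
  have h3 : IsUnit (LinearMap.toMatrix' (T p).toLinearMap).det :=
    (Matrix.isUnit_iff_isUnit_det _).1 (IsUnit.of_mul_eq_one_right _ h2)
  rw [h, Matrix.det_mul, Matrix.det_transpose]
  exact h3.mul h3

theorem gram_mulVec (hM : IsRiemannianMetric M g) {p : R4} (hp : p ∈ M) (v : R4) :
    gram g p *ᵥ v = fun l => g p v (Pi.single l 1) := by
  ext l
  have hv : v = ∑ j, v j • (Pi.single j 1 : R4) := by
    simpa using (Pi.basisFun ℝ (Fin 4)).sum_repr v |>.symm
  rw [hM.symm p hp]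
  conv_rhs => rw [hv]
  simp [Matrix.mulVec, dotProduct, gram, mul_comm]

/-- `W` is the Levi-Civita connection form of the orthonormal coframe `T`: it is skew-symmetric and
the first structure equation holds. -/
structure IsConnectionForm (M : Set R4) (T : R4 → R4 →L[ℝ] R4)
    (W : R4 → R4 →L[ℝ] R4 →L[ℝ] R4) : Prop where
  smooth : ContDiffOn ℝ ∞ W M
  skew : ∀ p ∈ M, ∀ X u v, W p X u ⬝ᵥ v = -(W p X v ⬝ᵥ u)
  torsion : ∀ p ∈ M, ∀ X Y, extOne T p X Y = W p Y (T p X) - W p X (T p Y)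

variable {W : R4 → R4 →L[ℝ] R4 →L[ℝ] R4}

/-- Uniqueness of the Levi-Civita connection: the vector with coframe components D_X T(Y) + W_X T(Y)
satisfies the Koszul formula, and the Gram matrix is invertible. -/
theorem coframe_christoffel (hM : IsOpen M) (hT : ContDiffOn ℝ ∞ T M)
    (hinv : ∀ p ∈ M, (T p).IsInvertible) (hgm : IsRiemannianMetric M g)
    (hg : ∀ p ∈ M, ∀ X Y, g p X Y = T p X ⬝ᵥ T p Y) (hW : IsConnectionForm M T W)
    {p : R4} (hp : p ∈ M) (X Y : R4) :
    T p (christoffel g p X Y) = fderiv ℝ T p X Y + W p X (T p Y) := by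
  set w := (T p).inverse (fderiv ℝ T p X Y + W p X (T p Y)) with hw
  have hTw : T p w = fderiv ℝ T p X Y + W p X (T p Y) := (hinv p hp).self_apply_inverse _
  have key : (fun l : Fin 4 => (1 / 2 : ℝ) * (fderiv ℝ g p X Y (Pi.single l 1)
      + fderiv ℝ g p Y X (Pi.single l 1) - fderiv ℝ g p (Pi.single l 1) X Y))
      = gram g p *ᵥ w := by
    rw [gram_mulVec hgm hp]
    ext l
    generalize (Pi.single l 1 : R4) = Z
    rw [hg p hp, hTw]
    simp only [fderiv_metric_of_coframe hM hT hgm.smooth hg hp]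
    have t1 := hW.torsion p hp X Y
    have t2 := hW.torsion p hp X Z
    have t3 := hW.torsion p hp Y Z
    simp only [extOne] at t1 t2 t3
    rw [sub_eq_iff_eq_add] at t1 t2 t3
    have s1 := hW.skew p hp X (T p Y) (T p Z)
    have s2 := hW.skew p hp Y (T p X) (T p Z)
    have s3 := hW.skew p hp Z (T p X) (T p Y)
    rw [t1, t2, t3]
    simp only [add_dotProduct, dotProduct_add, sub_dotProduct, dotProduct_sub]
    rw [dotProduct_comm (T p Y) (W p Z (T p X)), dotProduct_comm (T p Y) (W p X (T p Z)),
      dotProduct_comm (T p X) (W p Z (T p Y)), dotProduct_comm (T p X) (W p Y (T p Z)),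
      dotProduct_comm (T p X), dotProduct_comm (T p Y)]
    linarith
  have : christoffel g p X Y = w := by
    rw [christoffel, key, Matrix.mulVec_mulVec,
      Matrix.nonsing_inv_mul _ (gram_isUnit_det hinv hg hp), Matrix.one_mulVec]
  rw [this, hTw]

/-- The curvature form of the connection form `W`. -/
def curvatureForm (W : R4 → R4 →L[ℝ] R4 →L[ℝ] R4) (p X Y u : R4) : R4 :=
  extOne W p X Y u + W p X (W p Y u) - W p Y (W p X u)

theorem contDiffOn_inverse (hM : IsOpen M) (hT : ContDiffOn ℝ ∞ T M)
    (hinv : ∀ p ∈ M, (T p).IsInvertible) : ContDiffOn ℝ ∞ (fun p => (T p).inverse) M :=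
  fun p hp => ((hinv p hp).contDiffAt_map_inverse.comp p
    (contDiffAt_of_mem hM hT hp)).contDiffWithinAt

/-- The second structure equation. Differentiating the formula for `T p (christoffel g p Y Z)` and
antisymmetrizing in X, Y, the second derivatives of `T` disappear by symmetry, and the first
derivatives are absorbed by the connection. -/
theorem coframe_riemann (hM : IsOpen M) (hT : ContDiffOn ℝ ∞ T M)
    (hinv : ∀ p ∈ M, (T p).IsInvertible) (hgm : IsRiemannianMetric M g)
    (hg : ∀ p ∈ M, ∀ X Y, g p X Y = T p X ⬝ᵥ T p Y) (hW : IsConnectionForm M T W)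
    {p : R4} (hp : p ∈ M) (X Y Z : R4) :
    T p (riemann g p X Y Z) = curvatureForm W p X Y (T p Z) := by
  have hTd := differentiableAt_of_mem hM hT hp
  have hWd := differentiableAt_of_mem hM hW.smooth hp
  have hdT : DifferentiableAt ℝ (fderiv ℝ T) p :=
    differentiableAt_of_mem hM (hT.fderiv_of_isOpen hM (m := ∞) (by simp)) hp
  have hΓ := fun q (hq : q ∈ M) X Y => coframe_christoffel hM hT hinv hgm hg hW hq X Y
  have hrd : ∀ Y Z : R4,
      DifferentiableAt ℝ (fun q => fderiv ℝ T q Y Z + W q Y (T q Z)) p := fun Y Z =>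
    ((hdT.clm_apply (differentiableAt_const Y)).clm_apply (differentiableAt_const Z)).add
      ((hWd.clm_apply (differentiableAt_const Y)).clm_apply
        (hTd.clm_apply (differentiableAt_const Z)))
  -- Differentiability is read off from the coframe formula rather than from the inverse Gram
  -- matrix.
  have hΓd : ∀ Y Z, DifferentiableAt ℝ (fun q => christoffel g q Y Z) p := fun Y Z => by
    have h1 : (fun q => christoffel g q Y Z) =ᶠ[nhds p]
        fun q => (T q).inverse (fderiv ℝ T q Y Z + W q Y (T q Z)) := by
      filter_upwards [hM.mem_nhds hp] with q hq
      rw [← hΓ q hq, (hinv q hq).inverse_apply_self]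
    exact ((differentiableAt_of_mem hM (contDiffOn_inverse hM hT hinv) hp).clm_apply
      (hrd Y Z)).congr_of_eventuallyEq h1
  have hD : ∀ X Y Z, fderiv ℝ T p X (christoffel g p Y Z)
      + T p (fderiv ℝ (fun q => christoffel g q Y Z) p X)
      = fderiv ℝ (fderiv ℝ T) p X Y Z + fderiv ℝ W p X Y (T p Z)
        + W p Y (fderiv ℝ T p X Z) := fun X Y Z => by
    have h1 : (fun q => T q (christoffel g q Y Z)) =ᶠ[nhds p]
        fun q => fderiv ℝ T q Y Z + W q Y (T q Z) := by
      filter_upwards [hM.mem_nhds hp] with q hq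
      exact hΓ q hq Y Z
    have h2 := congrArg (fun L : R4 →L[ℝ] R4 => L X) h1.fderiv_eq
    rw [fderiv_clm_apply hTd (hΓd Y Z), fderiv_fun_add
      ((hdT.clm_apply (differentiableAt_const Y)).clm_apply (differentiableAt_const Z))
      ((hWd.clm_apply (differentiableAt_const Y)).clm_apply
        (hTd.clm_apply (differentiableAt_const Z))),
      fderiv_clm_apply (hWd.clm_apply (differentiableAt_const Y))
        (hTd.clm_apply (differentiableAt_const Z)),
      fderiv_clm_apply hTd (differentiableAt_const Z)] at h2
    simp only [add_apply, ContinuousLinearMap.comp_apply,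
      ContinuousLinearMap.flip_apply] at h2
    rw [fderiv_clm_apply_const hWd, fderiv_clm_apply_const
      (hdT.clm_apply (differentiableAt_const Y)), fderiv_clm_apply_const hdT] at h2
    simp at h2
    rw [add_comm, h2]
    abel
  have hsymm : fderiv ℝ (fderiv ℝ T) p X Y = fderiv ℝ (fderiv ℝ T) p Y X :=
    ((contDiffAt_of_mem hM hT hp).isSymmSndFDerivAt
      (by rw [minSmoothness_of_isRCLikeNormedField]; exact WithTop.coe_le_coe.2 le_top)).eq X Y
  have e1 := hD X Y Z
  have e2 := hD Y X Z
  have g1 := hΓ p hp X (christoffel g p Y Z)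
  have g2 := hΓ p hp Y (christoffel g p X Z)
  simp only [riemann, curvatureForm, extOne, map_add, map_sub, sub_apply]
  rw [g1, g2, hΓ p hp Y Z, hΓ p hp X Z, map_add, map_add, eq_sub_of_add_eq' e1, eq_sub_of_add_eq' e2, hsymm]
  abel

/-- The endomorphism field which is the constant `K` in the coframe `T`. -/
def frameEnd (T : R4 → R4 →L[ℝ] R4) (K : R4 →L[ℝ] R4) : EndField :=
  fun p => (T p).inverse ∘L K ∘L T p

theorem coframe_frameEnd {K : R4 →L[ℝ] R4} {p : R4} (hinv : (T p).IsInvertible) (X : R4) :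
    T p (frameEnd T K p X) = K (T p X) := by
  simp [frameEnd, hinv.self_apply_inverse]

theorem contDiffOn_frameEnd (hM : IsOpen M) (hT : ContDiffOn ℝ ∞ T M)
    (hinv : ∀ p ∈ M, (T p).IsInvertible) (K : R4 →L[ℝ] R4) :
    ContDiffOn ℝ ∞ (frameEnd T K) M :=
  (contDiffOn_inverse hM hT hinv).clm_comp (contDiffOn_const.clm_comp hT)

/-- The Nijenhuis tensor is tensorial: because J² = -1, the derivatives of the two vector fields
cancel and only those of J remain. -/
theorem nijenhuis_eq {J : EndField} {p : R4} (hJ : DifferentiableAt ℝ J p)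
    (hsq : ∀ X, J p (J p X) = -X) {X Y : R4 → R4} (hX : DifferentiableAt ℝ X p)
    (hY : DifferentiableAt ℝ Y p) :
    nijenhuis J X Y p = fderiv ℝ J p (J p (X p)) (Y p) - fderiv ℝ J p (J p (Y p)) (X p)
      + J p (fderiv ℝ J p (Y p) (X p)) - J p (fderiv ℝ J p (X p) (Y p)) := by
  simp only [nijenhuis, VectorField.lieBracket, fderiv_clm_apply hJ hX, fderiv_clm_apply hJ hY,
    add_apply, ContinuousLinearMap.comp_apply,
    ContinuousLinearMap.flip_apply, map_add, map_sub, hsq]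
  abel

/-- A constant complex structure in a coframe is Hermitian when the exterior derivative of the
coframe has no component of type `(0, 2)`. -/
theorem isHermitian_frameEnd (hM : IsOpen M) (hT : ContDiffOn ℝ ∞ T M)
    (hinv : ∀ p ∈ M, (T p).IsInvertible) (hgm : IsRiemannianMetric M g)
    (hg : ∀ p ∈ M, ∀ X Y, g p X Y = T p X ⬝ᵥ T p Y) {K : R4 →L[ℝ] R4}
    (hK : ∀ u, K (K u) = -u) (hKo : ∀ u v, K u ⬝ᵥ K v = u ⬝ᵥ v)
    (hd : ∀ p ∈ M, ∀ X Y,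
      extOne T p (frameEnd T K p X) (frameEnd T K p Y) - extOne T p X Y
        = K (extOne T p (frameEnd T K p X) Y + extOne T p X (frameEnd T K p Y))) :
    IsHermitian M g (frameEnd T K) := by
  have hsm := contDiffOn_frameEnd hM hT hinv K
  have hsq : ∀ p ∈ M, ∀ X, frameEnd T K p (frameEnd T K p X) = -X := fun p hp X =>
    (hinv p hp).injective (by
      rw [coframe_frameEnd (hinv p hp), coframe_frameEnd (hinv p hp), hK, map_neg])
  refine ⟨hgm, hsm, hsq, fun p hp X Y => ?_, fun X Y hX hY p hp => ?_⟩
  · rw [hg p hp, hg p hp, coframe_frameEnd (hinv p hp), coframe_frameEnd (hinv p hp), hKo]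
  · have hJd := differentiableAt_of_mem hM hsm hp
    have hTd := differentiableAt_of_mem hM hT hp
    rw [nijenhuis_eq hJd (hsq p hp) (differentiableAt_of_mem hM hX hp)
      (differentiableAt_of_mem hM hY hp)]
    generalize X p = X
    generalize Y p = Y
    -- Obtained by differentiating T(JY) = K T(Y) with Y constant; it trades derivatives of J for
    -- derivatives of the coframe.
    have hD : ∀ X Y, T p (fderiv ℝ (frameEnd T K) p X Y)
        = K (fderiv ℝ T p X Y) - fderiv ℝ T p X (frameEnd T K p Y) := fun X Y => by
      have h1 : (fun q => T q (frameEnd T K q Y)) =ᶠ[nhds p] fun q => K (T q Y) := by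
        filter_upwards [hM.mem_nhds hp] with q hq
        exact coframe_frameEnd (hinv q hq) Y
      have h2 := congrArg (fun L : R4 →L[ℝ] R4 => L X) h1.fderiv_eq
      rw [fderiv_clm_apply hTd (hJd.clm_apply (differentiableAt_const Y)),
        fderiv_clm_apply (differentiableAt_const K) (hTd.clm_apply (differentiableAt_const Y))] at h2
      simp only [add_apply, ContinuousLinearMap.comp_apply, ContinuousLinearMap.flip_apply] at h2
      rw [fderiv_clm_apply_const hJd, fderiv_clm_apply_const hTd] at h2
      simp at h2
      rw [← h2]
      abel
    apply (hinv p hp).injective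
    have h := hd p hp X Y
    simp only [extOne, map_add, map_sub, hD, coframe_frameEnd (hinv p hp), hK, map_zero] at h ⊢
    have h' := sub_eq_zero.2 h
    rw [← neg_eq_zero, ← h']
    abel

end Frames

/-! ### Exterior calculus of one- and two-forms; Lee forms of locally conformally Kähler structures.
-/

section Forms

theorem fin_two_eta {E : Type*} (v : Fin 2 → E) : ![v 0, v 1] = v := by
  ext i
  fin_cases i <;> rfl

theorem alt2_ext {Φ Ψ : Alt2} (h : ∀ X Y, Φ ![X, Y] = Ψ ![X, Y]) : Φ = Ψ := by
  ext v
  rw [← fin_two_eta v]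
  exact h _ _

section ExtOne

variable {F : Type*} [NormedAddCommGroup F] [NormedSpace ℝ F]

theorem extOne_add {α β : R4 → R4 →L[ℝ] F} {p : R4} (hα : DifferentiableAt ℝ α p)
    (hβ : DifferentiableAt ℝ β p) (X Y : R4) :
    extOne (fun q => α q + β q) p X Y = extOne α p X Y + extOne β p X Y := by
  simp only [extOne, fderiv_fun_add hα hβ, add_apply]
  abel

theorem extOne_sub {α β : R4 → R4 →L[ℝ] F} {p : R4} (hα : DifferentiableAt ℝ α p)
    (hβ : DifferentiableAt ℝ β p) (X Y : R4) :
    extOne (fun q => α q - β q) p X Y = extOne α p X Y - extOne β p X Y := by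
  simp only [extOne, fderiv_fun_sub hα hβ, sub_apply]
  abel

theorem extOne_smul {f : R4 → ℝ} {α : R4 → R4 →L[ℝ] F} {p : R4} (hf : DifferentiableAt ℝ f p)
    (hα : DifferentiableAt ℝ α p) (X Y : R4) :
    extOne (fun q => f q • α q) p X Y
      = fderiv ℝ f p X • α p Y - fderiv ℝ f p Y • α p X + f p • extOne α p X Y := by
  simp only [extOne, fderiv_fun_smul hf hα, add_apply, smul_apply,
    ContinuousLinearMap.smulRight_apply, smul_sub]
  abel

theorem extOne_const (α : R4 →L[ℝ] F) (p X Y : R4) : extOne (fun _ => α) p X Y = 0 := by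
  simp [extOne]

theorem extOne_smulRight {α : R4 → R4 →L[ℝ] ℝ} {p : R4} (hα : DifferentiableAt ℝ α p) (v : F)
    (X Y : R4) : extOne (fun q => (α q).smulRight v) p X Y = extOne α p X Y • v := by
  have h : ∀ X, fderiv ℝ (fun q => (α q).smulRight v) p X = (fderiv ℝ α p X).smulRight v :=
    fun X => by
      have := ((ContinuousLinearMap.smulRightL ℝ R4 F).flip v).hasFDerivAt.comp p hα.hasFDerivAt
      exact congrArg (fun L : R4 →L[ℝ] R4 →L[ℝ] F => L X) this.fderiv
  simp only [extOne, h, ContinuousLinearMap.smulRight_apply, sub_smul]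

end ExtOne

theorem extDeriv_apply_three {Ω : R4 → Alt2} (p X Y Z : R4) :
    extDeriv Ω p ![X, Y, Z]
      = fderiv ℝ Ω p X ![Y, Z] - fderiv ℝ Ω p Y ![X, Z] + fderiv ℝ Ω p Z ![X, Y] := by
  have h0 : Fin.removeNth 0 ![X, Y, Z] = ![Y, Z] := by ext i; fin_cases i <;> rfl
  have h1 : Fin.removeNth 1 ![X, Y, Z] = ![X, Z] := by ext i; fin_cases i <;> rfl
  have h2 : Fin.removeNth 2 ![X, Y, Z] = ![X, Y] := by ext i; fin_cases i <;> rfl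
  rw [extDeriv, ContinuousAlternatingMap.alternatizeUncurryFin_apply, Fin.sum_univ_three, h0, h1,
    h2]
  simp
  ring

/-- The exterior product of linear forms as a continuous bilinear map. -/
def wedgeL : (R4 →L[ℝ] ℝ) →L[ℝ] (R4 →L[ℝ] ℝ) →L[ℝ] Alt2 :=
  (LinearMap.mk₂ ℝ wedge
    (fun α α' β => alt2_ext fun X Y => by simp [wedge_apply]; ring)
    (fun c α β => alt2_ext fun X Y => by simp [wedge_apply]; ring)
    (fun α β β' => alt2_ext fun X Y => by simp [wedge_apply]; ring)
    (fun c α β => alt2_ext fun X Y => by simp [wedge_apply]; ring)).toContinuousBilinearMap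

theorem wedgeL_apply (α β : R4 →L[ℝ] ℝ) : wedgeL α β = wedge α β := rfl

theorem fderiv_wedge {α β : R4 → R4 →L[ℝ] ℝ} {p : R4} (hα : DifferentiableAt ℝ α p)
    (hβ : DifferentiableAt ℝ β p) (X : R4) :
    fderiv ℝ (fun q => wedge (α q) (β q)) p X
      = wedge (α p) (fderiv ℝ β p X) + wedge (fderiv ℝ α p X) (β p) := by
  simp only [← wedgeL_apply]
  rw [wedgeL.fderiv_of_bilinear hα hβ]
  simp

theorem differentiableAt_wedge {α β : R4 → R4 →L[ℝ] ℝ} {p : R4} (hα : DifferentiableAt ℝ α p)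
    (hβ : DifferentiableAt ℝ β p) : DifferentiableAt ℝ (fun q => wedge (α q) (β q)) p := by
  simp only [← wedgeL_apply]
  exact (wedgeL.hasFDerivAt_of_bilinear hα.hasFDerivAt hβ.hasFDerivAt).differentiableAt

/-- `d(α ∧ β) = dα ∧ β - α ∧ dβ`. -/
theorem extDeriv_wedge {α β : R4 → R4 →L[ℝ] ℝ} {p : R4} (hα : DifferentiableAt ℝ α p)
    (hβ : DifferentiableAt ℝ β p) (X Y Z : R4) :
    extDeriv (fun q => wedge (α q) (β q)) p ![X, Y, Z]
      = extOne α p X Y * β p Z - extOne α p X Z * β p Y + extOne α p Y Z * β p X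
        - (α p X * extOne β p Y Z - α p Y * extOne β p X Z + α p Z * extOne β p X Y) := by
  rw [extDeriv_apply_three]
  simp only [fderiv_wedge hα hβ, ContinuousAlternatingMap.add_apply, wedge_apply, extOne]
  ring

theorem extDeriv_eq_zero_of_apply {Ω : R4 → Alt2} {p : R4}
    (h : ∀ X Y Z, extDeriv Ω p ![X, Y, Z] = 0) : extDeriv Ω p = 0 := by
  ext v
  have : v = ![v 0, v 1, v 2] := by ext i; fin_cases i <;> rfl
  rw [this, h]
  rfl

/-- The exterior derivative of the Lee form of a locally conformally Kähler structure vanishes. -/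
theorem IsLocallyConformallyKahler.extOne_leeForm {M : Set R4} {g : BilinField} {J : EndField}
    {Ω : R4 → Alt2} {θ : R4 → R4 →L[ℝ] ℝ} (h : IsLocallyConformallyKahler M g J)
    (hΩ : IsKahlerForm M g J Ω) (hΩd : ∀ p ∈ M, DifferentiableAt ℝ Ω p) (hθ : IsLeeForm M Ω θ)
    (hnd : ∀ p ∈ M, ∀ η : R4 →L[ℝ] ℝ,
      (∀ X Y Z, η X * Ω p ![Y, Z] - η Y * Ω p ![X, Z] + η Z * Ω p ![X, Y] = 0) → η = 0)
    {p : R4} (hp : p ∈ M) (X Y : R4) : extOne θ p X Y = 0 := by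
  obtain ⟨N, hN, hpN, hNM, f, hf, -, Ω', hΩ', hΩ'c⟩ := h p hp
  -- The Kähler form of e^f g is e^f Ω. Its closedness gives (df + 2θ) ∧ Ω = 0, and `hnd` cancels Ω.
  -- So θ is locally exact, hence closed.
  have hdf : ∀ q ∈ N, fderiv ℝ f q = (-2 : ℝ) • θ q := fun q hq => by
    have hfd := differentiableAt_of_mem hN hf hq
    have h1 : Ω' =ᶠ[nhds q] fun r => Real.exp (f r) • Ω r := by
      filter_upwards [hN.mem_nhds hq] with r hr
      refine alt2_ext fun X Y => ?_
      rw [hΩ' r hr, ContinuousAlternatingMap.smul_apply, hΩ r (hNM hr)]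
      simp
    have h2 := hΩ'c q hq
    rw [h1.extDeriv_eq] at h2
    rw [← sub_eq_zero]
    refine hnd q (hNM hq) _ fun X Y Z => ?_
    have h3 := congrArg (fun Φ => Φ ![X, Y, Z]) h2
    have h4 := hθ.2 q (hNM hq) X Y Z
    simp only [extDeriv_apply_three, fderiv_fun_smul hfd.exp (hΩd q (hNM hq)),
      fderiv_exp hfd] at h3 h4
    simp at h3
    have h5 : Real.exp (f q) * ((fderiv ℝ f q X * Ω q ![Y, Z] - fderiv ℝ f q Y * Ω q ![X, Z]
        + fderiv ℝ f q Z * Ω q ![X, Y]) + (fderiv ℝ Ω q X ![Y, Z] - fderiv ℝ Ω q Y ![X, Z]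
        + fderiv ℝ Ω q Z ![X, Y])) = 0 := by linear_combination h3
    have h6 := (mul_eq_zero.1 h5).resolve_left (Real.exp_ne_zero _)
    rw [h4] at h6
    simp
    linear_combination h6
  have h1 : fderiv ℝ f =ᶠ[nhds p] fun q => (-2 : ℝ) • θ q := by
    filter_upwards [hN.mem_nhds hpN] with q hq using hdf q hq
  have hsymm : fderiv ℝ (fderiv ℝ f) p X Y = fderiv ℝ (fderiv ℝ f) p Y X :=
    ((contDiffAt_of_mem hN hf hpN).isSymmSndFDerivAt
      (by rw [minSmoothness_of_isRCLikeNormedField]; exact WithTop.coe_le_coe.2 le_top)).eq X Y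
  have hθN := differentiableAt_of_mem hN (hθ.1.mono hNM) hpN
  rw [h1.fderiv_eq, fderiv_fun_const_smul hθN] at hsymm
  simp at hsymm
  simp [extOne, hsymm]

end Forms

/-! ### Linear algebra of the two opposite complex structures on ℝ⁴. -/

section Algebra

/-- The orthogonal complex structure `e₀ ↦ e₁`, `e₂ ↦ ε e₃` of `ℝ⁴`, for `ε = ±1`. -/
def blockEnd (ε : ℝ) : R4 →L[ℝ] R4 :=
  LinearMap.toContinuousLinearMap
    { toFun := fun u => ![-u 1, u 0, -(ε * u 3), ε * u 2]
      map_add' := fun u v => by ext i; fin_cases i <;> simp <;> ring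
      map_smul' := fun c u => by ext i; fin_cases i <;> simp <;> ring }

theorem blockEnd_apply (ε : ℝ) (u : R4) :
    blockEnd ε u = ![-u 1, u 0, -(ε * u 3), ε * u 2] := rfl

theorem blockEnd_blockEnd {ε : ℝ} (hε : ε ^ 2 = 1) (u : R4) : blockEnd ε (blockEnd ε u) = -u := by
  ext i
  fin_cases i <;> simp [blockEnd_apply] <;> linear_combination u _ * hε

theorem blockEnd_dotProduct {ε : ℝ} (hε : ε ^ 2 = 1) (u v : R4) :
    blockEnd ε u ⬝ᵥ blockEnd ε v = u ⬝ᵥ v := by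
  rw [dotProduct_four, dotProduct_four]
  simp [blockEnd_apply]
  linear_combination (u 2 * v 2 + u 3 * v 3) * hε

theorem blockEnd_dotProduct_right (ε : ℝ) (u v : R4) :
    blockEnd ε u ⬝ᵥ v = u 0 * v 1 - u 1 * v 0 + ε * (u 2 * v 3 - u 3 * v 2) := by
  rw [dotProduct_four]
  simp [blockEnd_apply]
  ring

/-- A skew-symmetric orthogonal `4 × 4` matrix with negative Pfaffian is anti-self-dual. -/
theorem antiSelfDual_of_pfaffian_neg {b₁ b₂ b₃ c₁ c₂ c₃ : ℝ}
    (h0 : b₁ ^ 2 + b₂ ^ 2 + b₃ ^ 2 = 1) (h1 : b₁ ^ 2 + c₃ ^ 2 + c₂ ^ 2 = 1)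
    (h2 : b₂ ^ 2 + c₃ ^ 2 + c₁ ^ 2 = 1) (h3 : b₃ ^ 2 + c₂ ^ 2 + c₁ ^ 2 = 1)
    (h12 : b₁ * b₂ = c₁ * c₂) (h13 : b₁ * b₃ = c₁ * c₃)
    (hneg : b₁ * c₁ + b₂ * c₂ + b₃ * c₃ < 0) : b₁ = -c₁ := by
  -- The sum of the first two row norms minus the sum of the last two is 2(b₁² - c₁²). If b₁ = c₁ ≠
  -- 0, orthogonality of rows forces bᵢ = cᵢ for every i, and the Pfaffian is a sum of squares.
  have hs : b₁ ^ 2 = c₁ ^ 2 := by linarith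
  rcases sq_eq_sq_iff_eq_or_eq_neg.1 hs with h | h
  · by_cases hb : b₁ = 0
    · rw [hb] at h ⊢
      rw [← h, neg_zero]
    · rw [← h] at h12 h13
      have e2 := mul_left_cancel₀ hb h12
      have e3 := mul_left_cancel₀ hb h13
      rw [← h, ← e2, ← e3] at hneg
      nlinarith [sq_nonneg b₁, sq_nonneg b₂, sq_nonneg b₃]
  · exact h

end Algebra

/-! ### Consequences of the algebraic form of the curvature. -/

section Model

variable {M : Set R4} {g : BilinField} {T : R4 → R4 →L[ℝ] R4}

/-- Parseval's identity: a square matrix with orthonormal rows has orthonormal columns. -/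
theorem sum_dotProduct_mul_of_orthonormal {x : Fin 4 → R4}
    (hx : ∀ i j, x i ⬝ᵥ x j = if i = j then 1 else 0) (u v : R4) :
    ∑ k, (u ⬝ᵥ x k) * (v ⬝ᵥ x k) = u ⬝ᵥ v := by
  have h1 : Matrix.of x * (Matrix.of x)ᵀ = 1 := by
    ext i j
    simpa [Matrix.mul_apply, Matrix.one_apply, dotProduct] using hx i j
  have h2 : (Matrix.of x)ᵀ * Matrix.of x = 1 := mul_eq_one_comm.1 h1
  have h3 : ∀ i j, ∑ k, x k i * x k j = if i = j then 1 else 0 := fun i j => by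
    simpa [Matrix.mul_apply, Matrix.one_apply] using congrFun (congrFun h2 i) j
  calc ∑ k, (u ⬝ᵥ x k) * (v ⬝ᵥ x k) = ∑ i, ∑ j, u i * v j * ∑ k, x k i * x k j := by
        simp only [dotProduct, Fin.sum_univ_four]
        ring
    _ = u ⬝ᵥ v := by simp [h3, dotProduct]

/-- In any orthonormal basis the matrix of Ω is skew and orthogonal, so it is self-dual or
anti-self-dual, and the sign of its Pfaffian decides which. -/
theorem isOpposite_frameEnd (hinv : ∀ p ∈ M, (T p).IsInvertible)
    (hg : ∀ p ∈ M, ∀ X Y, g p X Y = T p X ⬝ᵥ T p Y) :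
    IsOpposite M g (frameEnd T (blockEnd (-1))) (frameEnd T (blockEnd 1)) := by
  intro p hp e he hpos
  set x : Fin 4 → R4 := fun i => T p (e i) with hx
  have hJ : ∀ ε i j, g p (frameEnd T (blockEnd ε) p (e i)) (e j) = blockEnd ε (x i) ⬝ᵥ x j :=
    fun ε i j => by rw [hg p hp, coframe_frameEnd (hinv p hp)]
  have ho : ∀ i j, x i ⬝ᵥ x j = if i = j then 1 else 0 := fun i j => by
    rw [← he i j, hg p hp]
  have hb : ∀ i j, ∑ k, (blockEnd 1 (x i) ⬝ᵥ x k) * (blockEnd 1 (x j) ⬝ᵥ x k)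
      = if i = j then 1 else 0 := fun i j => by
    rw [sum_dotProduct_mul_of_orthonormal ho, blockEnd_dotProduct (by norm_num), ho]
  have hskew : ∀ i j, blockEnd 1 (x i) ⬝ᵥ x j = -(blockEnd 1 (x j) ⬝ᵥ x i) := fun i j => by
    simp only [blockEnd_dotProduct_right]
    ring
  have hzero : ∀ i, blockEnd 1 (x i) ⬝ᵥ x i = 0 := fun i => by
    simp only [blockEnd_dotProduct_right]
    ring
  simp only [orientationValue, hJ] at hpos ⊢
  -- The Pfaffian of the form of `blockEnd ε` in the basis x is ε det x, so positivity for ε = -1 is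
  -- negativity for ε = 1.
  have hneg : (blockEnd 1 (x 0) ⬝ᵥ x 1) * (blockEnd 1 (x 2) ⬝ᵥ x 3)
      + (blockEnd 1 (x 0) ⬝ᵥ x 2) * -(blockEnd 1 (x 1) ⬝ᵥ x 3)
      + (blockEnd 1 (x 0) ⬝ᵥ x 3) * (blockEnd 1 (x 1) ⬝ᵥ x 2) < 0 := by
    rw [← neg_pos]
    refine hpos.trans_eq ?_
    simp only [blockEnd_dotProduct_right]
    ring
  have b00 := hb 0 0
  have b11 := hb 1 1
  have b22 := hb 2 2
  have b33 := hb 3 3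
  have b12 := hb 1 2
  have b13 := hb 1 3
  simp only [Fin.sum_univ_four, hzero, hskew 1 0, hskew 2 0, hskew 3 0, hskew 2 1, hskew 3 1,
    hskew 3 2, if_true] at b00 b11 b22 b33 b12 b13
  rw [if_neg (by decide)] at b12 b13
  apply antiSelfDual_of_pfaffian_neg _ _ _ _ _ _ hneg <;> linarith

/-- The model of the curvature form `R(X, Y)Z` in the coframe, at a point. -/
def curvatureModel (a k : ℝ) (x y u : R4) : R4 :=
  let θ : Fin 4 → Fin 4 → ℝ := fun i j => x i * y j - x j * y i
  ![(k * θ 0 1 + 2 * a ^ 2 * θ 2 3) * u 1 + a ^ 2 * (θ 1 3 - θ 0 2) * u 2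
      - a ^ 2 * (θ 0 3 + θ 1 2) * u 3,
    -(k * θ 0 1 + 2 * a ^ 2 * θ 2 3) * u 0 - a ^ 2 * (θ 0 3 + θ 1 2) * u 2
      - a ^ 2 * (θ 1 3 - θ 0 2) * u 3,
    -(a ^ 2 * (θ 1 3 - θ 0 2)) * u 0 + a ^ 2 * (θ 0 3 + θ 1 2) * u 1
      + (2 * a ^ 2 * θ 0 1 - 4 * a ^ 2 * θ 2 3) * u 3,
    a ^ 2 * (θ 0 3 + θ 1 2) * u 0 + a ^ 2 * (θ 1 3 - θ 0 2) * u 1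
      - (2 * a ^ 2 * θ 0 1 - 4 * a ^ 2 * θ 2 3) * u 2]

/-- `curvatureModel` as a linear map in its first vector argument. -/
def curvatureModelLin (a k : ℝ) (y u : R4) : R4 →ₗ[ℝ] R4 where
  toFun x := curvatureModel a k x y u
  map_add' x x' := by ext i; fin_cases i <;> simp [curvatureModel] <;> ring
  map_smul' c x := by ext i; fin_cases i <;> simp [curvatureModel] <;> ring

theorem curvatureModel_trace (a k : ℝ) (y u : R4) :
    LinearMap.trace ℝ R4 (curvatureModelLin a k y u)
      = (k - 2 * a ^ 2) * (y 0 * u 0 + y 1 * u 1)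
        - 6 * a ^ 2 * (y 2 * u 2 + y 3 * u 3) := by
  rw [LinearMap.trace_eq_matrix_trace ℝ (Pi.basisFun ℝ (Fin 4)), Matrix.trace]
  simp [Fin.sum_univ_four, curvatureModelLin, curvatureModel]
  ring

/-- The coframe conjugates X ↦ R(X, Y)Z to the model map, and the trace is invariant under
conjugation. -/
theorem ricci_of_curvatureModel (hinv : ∀ p ∈ M, (T p).IsInvertible) {a : ℝ} {k : R4 → ℝ}
    (hR : ∀ p ∈ M, ∀ X Y Z,
      T p (riemann g p X Y Z) = curvatureModel a (k p) (T p X) (T p Y) (T p Z))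
    {p : R4} (hp : p ∈ M) (Y Z : R4) :
    ricci g p Y Z = (k p - 2 * a ^ 2) * (T p Y 0 * T p Z 0 + T p Y 1 * T p Z 1)
        - 6 * a ^ 2 * (T p Y 2 * T p Z 2 + T p Y 3 * T p Z 3) := by
  have h : ∀ X, riemann g p X Y Z = ((T p).inverse.toLinearMap ∘ₗ
      (curvatureModelLin a (k p) (T p Y) (T p Z) ∘ₗ (T p).toLinearMap)) X := fun X =>
    (hinv p hp).injective (by
      rw [hR p hp]
      simp [(hinv p hp).self_apply_inverse, curvatureModelLin])
  have h2 : (T p).toLinearMap ∘ₗ (T p).inverse.toLinearMap = LinearMap.id := by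
    ext1
    ext1
    simp [(hinv p hp).self_apply_inverse]
  have h3 : ricci g p Y Z = LinearMap.trace ℝ R4 ((T p).inverse.toLinearMap ∘ₗ
      (curvatureModelLin a (k p) (T p Y) (T p Z) ∘ₗ (T p).toLinearMap)) := by
    rw [LinearMap.trace_eq_matrix_trace ℝ (Pi.basisFun ℝ (Fin 4)), Matrix.trace]
    simp only [ricci, h, Matrix.diag_apply, LinearMap.toMatrix_apply, Pi.basisFun_apply,
      Pi.basisFun_repr]
  rw [h3, LinearMap.trace_comp_comm', LinearMap.comp_assoc, h2, LinearMap.comp_id,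
    curvatureModel_trace]

/-- The Ricci form is a multiple of the scalar product on each of the coordinate planes 01 and 23,
and `blockEnd` acts isometrically on each. -/
theorem ricciInvariant_of_curvatureModel (hinv : ∀ p ∈ M, (T p).IsInvertible) {a : ℝ} {k : R4 → ℝ}
    (hR : ∀ p ∈ M, ∀ X Y Z,
      T p (riemann g p X Y Z) = curvatureModel a (k p) (T p X) (T p Y) (T p Z)) :
    RicciInvariant M g (frameEnd T (blockEnd 1)) := by
  intro p hp X Y
  rw [ricci_of_curvatureModel hinv hR hp, ricci_of_curvatureModel hinv hR hp,
    coframe_frameEnd (hinv p hp), coframe_frameEnd (hinv p hp)]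
  simp [blockEnd_apply]
  ring

theorem isQCH_of_curvatureModel (hinv : ∀ p ∈ M, (T p).IsInvertible)
    (hg : ∀ p ∈ M, ∀ X Y, g p X Y = T p X ⬝ᵥ T p Y) {a : ℝ} {k : R4 → ℝ}
    (hR : ∀ p ∈ M, ∀ X Y Z,
      T p (riemann g p X Y Z) = curvatureModel a (k p) (T p X) (T p Y) (T p Z))
    {D : R4 → Submodule ℝ R4} (hDp : IsPlaneDistribution M D)
    (hD : ∀ p ∈ M, ∀ V, V ∈ D p ↔ T p V 0 = 0 ∧ T p V 1 = 0)
    (hK : IsKahler M g (frameEnd T (blockEnd (-1)))) :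
    IsQCH M g (frameEnd T (blockEnd (-1))) D := by
  -- For a unit vector, r² and 1 - r² are the squared norms of its components in 𝒟 and in the
  -- orthogonal complement; the model evaluates to this quadratic form in them.
  refine ⟨hK, hDp, fun p hp X hX => ?_, fun p r => k p * (1 - r ^ 2) ^ 2
    - 8 * a ^ 2 * (1 - r ^ 2) * r ^ 2 - 4 * a ^ 2 * (r ^ 2) ^ 2, fun p hp X Z hX hZ => ?_⟩
  · rw [hD p hp] at hX ⊢
    rw [coframe_frameEnd (hinv p hp)]
    simp [blockEnd_apply, hX.1, hX.2]
  · have hZ1 := (hD p hp Z).1 hZ.1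
    have hp2 : ∀ i : Fin 4, i = 2 ∨ i = 3 → T p Z i = T p X i := fun i hi => by
      -- The dual frame vectors of indices 2 and 3 lie in 𝒟; testing the projection against them
      -- recovers the components of X.
      have h1 : T p ((T p).inverse (Pi.single i 1)) = Pi.single i 1 :=
        (hinv p hp).self_apply_inverse _
      have h2 := hZ.2 ((T p).inverse (Pi.single i 1)) ((hD p hp _).2 (by
        rw [h1]; rcases hi with rfl | rfl <;> simp))
      rw [hg p hp, h1, map_sub] at h2
      simp at h2
      linarith
    have hr : Real.sqrt (g p Z Z) ^ 2 = T p X 2 ^ 2 + T p X 3 ^ 2 := by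
      have h1 : g p Z Z = T p X 2 ^ 2 + T p X 3 ^ 2 := by
        rw [hg p hp, dotProduct_four, hZ1.1, hZ1.2, hp2 2 (by simp), hp2 3 (by simp)]
        ring
      rw [h1, Real.sq_sqrt (by positivity)]
    rw [hg p hp, dotProduct_four] at hX
    have h1 : 1 - (T p X 2 ^ 2 + T p X 3 ^ 2) = T p X 0 ^ 2 + T p X 1 ^ 2 := by linarith
    beta_reduce
    rw [hr, h1, hg p hp, hR p hp, coframe_frameEnd (hinv p hp), dotProduct_four]
    simp [blockEnd_apply, curvatureModel]
    ring

end Model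

/-! ### Smoothness and exterior derivatives of the explicit forms. -/

section Data

/-- The hypotheses on the functions `h` and `H`. -/
structure IsSolution (a : ℝ) (U : Set (ℝ × ℝ)) (h H : ℝ × ℝ → ℝ) : Prop where
  ne_zero : a ≠ 0
  isOpen : IsOpen U
  h_smooth : ContDiffOn ℝ ∞ h U
  h_pos : ∀ q ∈ U, 0 < h q
  H_smooth : ContDiffOn ℝ ∞ H U
  H_pos : ∀ q ∈ U, 0 < H q
  laplacian_eq : ∀ q ∈ U, laplacian2 (fun r => Real.log (H r)) q
    = -2 * a ^ 2 * h q ^ 2 + 4 * a ^ 2 * H q ^ 2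

/-! ### Functions on the plane and on the line, pulled back to `ℝ⁴` -/

theorem dcoord_apply (i : Fin 4) (X : R4) : dcoord i X = X i := rfl

theorem hasFDerivAt_pullback {F : ℝ × ℝ → ℝ} {p : R4} (hF : DifferentiableAt ℝ F (p 0, p 1)) :
    HasFDerivAt (fun q : R4 => F (q 0, q 1))
      (partialX F (p 0, p 1) • dcoord 0 + partialY F (p 0, p 1) • dcoord 1) p := by
  have h1 := (hF.hasFDerivAt (x := (p 0, p 1))).comp p
    ((dcoord 0).prod (dcoord 1)).hasFDerivAt
  refine h1.congr_fderiv (ContinuousLinearMap.ext fun X => ?_)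
  have : (X 0, X 1) = X 0 • ((1, 0) : ℝ × ℝ) + X 1 • ((0, 1) : ℝ × ℝ) := by simp
  simp only [partialX, partialY, add_apply, smul_apply, dcoord_apply, smul_eq_mul,
    ContinuousLinearMap.comp_apply, ContinuousLinearMap.prod_apply]
  rw [this, map_add, map_smul, map_smul]
  simp [mul_comm]

theorem hasFDerivAt_coord {φ : ℝ → ℝ} {c : ℝ} {p : R4} {i : Fin 4} (hφ : HasDerivAt φ c (p i)) :
    HasFDerivAt (fun q : R4 => φ (q i)) (c • dcoord i) p :=
  hφ.comp_hasFDerivAt p (dcoord i).hasFDerivAt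

theorem hasFDerivAt_sinh (b : ℝ) (i : Fin 4) (p : R4) :
    HasFDerivAt (fun q : R4 => Real.sinh (b * q i)) ((Real.cosh (b * p i) * b) • dcoord i) p :=
  hasFDerivAt_coord (φ := fun s => Real.sinh (b * s)) (by
    simpa using ((hasDerivAt_id (p i)).const_mul b).sinh)

theorem hasFDerivAt_cosh (b : ℝ) (i : Fin 4) (p : R4) :
    HasFDerivAt (fun q : R4 => Real.cosh (b * q i)) ((Real.sinh (b * p i) * b) • dcoord i) p :=
  hasFDerivAt_coord (φ := fun s => Real.cosh (b * s)) (by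
    simpa using ((hasDerivAt_id (p i)).const_mul b).cosh)

theorem hasFDerivAt_sin (b : ℝ) (i : Fin 4) (p : R4) :
    HasFDerivAt (fun q : R4 => Real.sin (b * q i)) ((Real.cos (b * p i) * b) • dcoord i) p :=
  hasFDerivAt_coord (φ := fun s => Real.sin (b * s)) (by
    simpa using ((hasDerivAt_id (p i)).const_mul b).sin)

theorem hasFDerivAt_cos (b : ℝ) (i : Fin 4) (p : R4) :
    HasFDerivAt (fun q : R4 => Real.cos (b * q i)) ((-Real.sin (b * p i) * b) • dcoord i) p :=
  hasFDerivAt_coord (φ := fun s => Real.cos (b * s)) (by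
    simpa using ((hasDerivAt_id (p i)).const_mul b).cos)

theorem hasFDerivAt_tanh (b : ℝ) (i : Fin 4) (p : R4) :
    HasFDerivAt (fun q : R4 => b * Real.tanh (b * q i))
      ((b ^ 2 / Real.cosh (b * p i) ^ 2) • dcoord i) p :=
  hasFDerivAt_coord (φ := fun s => b * Real.tanh (b * s)) (by
    have h1 : HasDerivAt (fun s => Real.sinh (b * s)) (Real.cosh (b * p i) * b) (p i) := by
      simpa using ((hasDerivAt_id (p i)).const_mul b).sinh
    have h2 : HasDerivAt (fun s => Real.cosh (b * s)) (Real.sinh (b * p i) * b) (p i) := by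
      simpa using ((hasDerivAt_id (p i)).const_mul b).cosh
    have hc := (Real.cosh_pos (b * p i)).ne'
    have h3 := ((h1.fun_div h2 hc).const_mul b).congr_deriv
      (g' := b ^ 2 / Real.cosh (b * p i) ^ 2) (by
        field_simp
        linear_combination b ^ 2 * Real.cosh_sq (b * p i))
    simpa only [Real.tanh_eq_sinh_div_cosh] using h3)

variable {U : Set (ℝ × ℝ)}

theorem isOpen_domain (hU : IsOpen U) : IsOpen (domain U) :=
  (hU.preimage (by fun_prop : Continuous fun p : R4 => (p 0, p 1))).inter
    (isOpen_lt (continuous_apply 2) continuous_const)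

theorem contDiffOn_pullback {F : ℝ × ℝ → ℝ} (hF : ContDiffOn ℝ ∞ F U) :
    ContDiffOn ℝ ∞ (fun p : R4 => F (p 0, p 1)) (domain U) :=
  hF.comp (((dcoord 0).prod (dcoord 1)).contDiff.contDiffOn) fun _ hp => hp.1

theorem contDiffOn_partialX (hU : IsOpen U) {F : ℝ × ℝ → ℝ} (hF : ContDiffOn ℝ ∞ F U) :
    ContDiffOn ℝ ∞ (partialX F) U :=
  (hF.fderiv_of_isOpen hU (m := ∞) (by simp)).clm_apply contDiffOn_const

theorem contDiffOn_partialY (hU : IsOpen U) {F : ℝ × ℝ → ℝ} (hF : ContDiffOn ℝ ∞ F U) :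
    ContDiffOn ℝ ∞ (partialY F) U :=
  (hF.fderiv_of_isOpen hU (m := ∞) (by simp)).clm_apply contDiffOn_const

theorem fderiv_log {F : ℝ × ℝ → ℝ} {q : ℝ × ℝ} (hF : DifferentiableAt ℝ F q) (h0 : F q ≠ 0) :
    fderiv ℝ (fun r => Real.log (F r)) q = (F q)⁻¹ • fderiv ℝ F q :=
  (hF.hasFDerivAt.log h0).fderiv

theorem partialX_eq_mul_log {F : ℝ × ℝ → ℝ} {q : ℝ × ℝ} (hF : DifferentiableAt ℝ F q)
    (h0 : F q ≠ 0) : partialX F q = F q * partialX (fun r => Real.log (F r)) q := by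
  simp only [partialX, fderiv_log hF h0, smul_apply, smul_eq_mul]
  field_simp

theorem partialY_eq_mul_log {F : ℝ × ℝ → ℝ} {q : ℝ × ℝ} (hF : DifferentiableAt ℝ F q)
    (h0 : F q ≠ 0) : partialY F q = F q * partialY (fun r => Real.log (F r)) q := by
  simp only [partialY, fderiv_log hF h0, smul_apply, smul_eq_mul]
  field_simp

theorem contDiffOn_dcoord_smul {f : R4 → ℝ} {s : Set R4} (hf : ContDiffOn ℝ ∞ f s) (i : Fin 4) :
    ContDiffOn ℝ ∞ (fun p => f p • dcoord i) s := hf.smul contDiffOn_const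

/-- The exterior derivative of `f dx_i`. -/
theorem extOne_dcoord_smul {f : R4 → ℝ} {f' : R4 →L[ℝ] ℝ} {p : R4} (hf : HasFDerivAt f f' p)
    (i : Fin 4) (X Y : R4) :
    extOne (fun q => f q • dcoord i) p X Y = f' X * Y i - f' Y * X i := by
  rw [extOne_smul hf.differentiableAt (differentiableAt_const _), extOne_const, hf.fderiv]
  simp [dcoord_apply]

/-! ### The auxiliary one-forms -/

/-- The form `H (cos 2at dx - sin 2at dy)`. -/
def formP (a : ℝ) (H : ℝ × ℝ → ℝ) (p : R4) : R4 →L[ℝ] ℝ :=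
  (Real.cos (2 * a * p 3) * H (p 0, p 1)) • dcoord 0
    - (Real.sin (2 * a * p 3) * H (p 0, p 1)) • dcoord 1

/-- The form `H (sin 2at dx + cos 2at dy)`. -/
def formQ (a : ℝ) (H : ℝ × ℝ → ℝ) (p : R4) : R4 →L[ℝ] ℝ :=
  (Real.sin (2 * a * p 3) * H (p 0, p 1)) • dcoord 0
    + (Real.cos (2 * a * p 3) * H (p 0, p 1)) • dcoord 1

/-- The form `dt - l₂ dx - n₂ dy`. -/
def formA (a : ℝ) (H : ℝ × ℝ → ℝ) (p : R4) : R4 →L[ℝ] ℝ :=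
  dcoord 3 - l2 a H (p 0, p 1) • dcoord 0 - n2 a H (p 0, p 1) • dcoord 1

/-- The form `cosh 2az A - sinh 2az P`. -/
def formB (a : ℝ) (H : ℝ × ℝ → ℝ) (p : R4) : R4 →L[ℝ] ℝ :=
  Real.cosh (2 * a * p 2) • formA a H p - Real.sinh (2 * a * p 2) • formP a H p

/-- The Hodge dual `-(ln h)_y dx + (ln h)_x dy` of `d ln h`. -/
def starDlog (h : ℝ × ℝ → ℝ) (p : R4) : R4 →L[ℝ] ℝ :=
  partialX (fun r => Real.log (h r)) (p 0, p 1) • dcoord 1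
    - partialY (fun r => Real.log (h r)) (p 0, p 1) • dcoord 0

/-- The form `a tanh az dz + d ln h`. -/
def dlogFactor (a : ℝ) (h : ℝ × ℝ → ℝ) (p : R4) : R4 →L[ℝ] ℝ :=
  (a * Real.tanh (a * p 2)) • dcoord 2
    + (partialX (fun r => Real.log (h r)) (p 0, p 1) • dcoord 0
        + partialY (fun r => Real.log (h r)) (p 0, p 1) • dcoord 1)

/-- `θ₁ = h cosh az dx`. -/
def theta1 (a : ℝ) (h : ℝ × ℝ → ℝ) (p : R4) : R4 →L[ℝ] ℝ :=
  (Real.cosh (a * p 2) * h (p 0, p 1)) • dcoord 0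

/-- `θ₂ = h cosh az dy`. -/
def theta2 (a : ℝ) (h : ℝ × ℝ → ℝ) (p : R4) : R4 →L[ℝ] ℝ :=
  (Real.cosh (a * p 2) * h (p 0, p 1)) • dcoord 1

variable {a : ℝ} {h H : ℝ × ℝ → ℝ}

theorem theta3_eq : theta3 a H = fun p =>
    Real.sinh (2 * a * p 2) • formA a H p - Real.cosh (2 * a * p 2) • formP a H p := by
  ext p X
  simp [theta3, formA, formP]
  ring

theorem theta4_eq : theta4 a H = fun p => dcoord 2 - formQ a H p := by
  ext p X
  simp [theta4, formQ]
  ring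

namespace IsSolution

theorem logH_smooth (hs : IsSolution a U h H) : ContDiffOn ℝ ∞ (fun r => Real.log (H r)) U :=
  hs.H_smooth.log fun q hq => (hs.H_pos q hq).ne'

theorem logh_smooth (hs : IsSolution a U h H) : ContDiffOn ℝ ∞ (fun r => Real.log (h r)) U :=
  hs.h_smooth.log fun q hq => (hs.h_pos q hq).ne'

theorem contDiffOn_l2 (hs : IsSolution a U h H) : ContDiffOn ℝ ∞ (l2 a H) U :=
  contDiffOn_const.mul (contDiffOn_partialY hs.isOpen hs.logH_smooth)

theorem contDiffOn_n2 (hs : IsSolution a U h H) : ContDiffOn ℝ ∞ (n2 a H) U :=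
  contDiffOn_const.mul (contDiffOn_partialX hs.isOpen hs.logH_smooth)

theorem contDiffOn_formP (hs : IsSolution a U h H) : ContDiffOn ℝ ∞ (formP a H) (domain U) :=
  (contDiffOn_dcoord_smul ((by fun_prop : ContDiff ℝ ∞ fun p : R4 =>
    Real.cos (2 * a * p 3)).contDiffOn.mul (contDiffOn_pullback hs.H_smooth)) 0).sub
  (contDiffOn_dcoord_smul ((by fun_prop : ContDiff ℝ ∞ fun p : R4 =>
    Real.sin (2 * a * p 3)).contDiffOn.mul (contDiffOn_pullback hs.H_smooth)) 1)

theorem contDiffOn_formQ (hs : IsSolution a U h H) : ContDiffOn ℝ ∞ (formQ a H) (domain U) :=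
  (contDiffOn_dcoord_smul ((by fun_prop : ContDiff ℝ ∞ fun p : R4 =>
    Real.sin (2 * a * p 3)).contDiffOn.mul (contDiffOn_pullback hs.H_smooth)) 0).add
  (contDiffOn_dcoord_smul ((by fun_prop : ContDiff ℝ ∞ fun p : R4 =>
    Real.cos (2 * a * p 3)).contDiffOn.mul (contDiffOn_pullback hs.H_smooth)) 1)

theorem contDiffOn_formA (hs : IsSolution a U h H) : ContDiffOn ℝ ∞ (formA a H) (domain U) :=
  (contDiffOn_const.sub (contDiffOn_dcoord_smul (contDiffOn_pullback hs.contDiffOn_l2) 0)).sub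
    (contDiffOn_dcoord_smul (contDiffOn_pullback hs.contDiffOn_n2) 1)

theorem contDiffOn_formB (hs : IsSolution a U h H) : ContDiffOn ℝ ∞ (formB a H) (domain U) :=
  ((by fun_prop : ContDiff ℝ ∞ fun p : R4 => Real.cosh (2 * a * p 2)).contDiffOn.smul
    hs.contDiffOn_formA).sub
  ((by fun_prop : ContDiff ℝ ∞ fun p : R4 => Real.sinh (2 * a * p 2)).contDiffOn.smul
    hs.contDiffOn_formP)

theorem contDiffOn_theta3 (hs : IsSolution a U h H) : ContDiffOn ℝ ∞ (theta3 a H) (domain U) := by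
  rw [theta3_eq]
  exact ((by fun_prop : ContDiff ℝ ∞ fun p : R4 => Real.sinh (2 * a * p 2)).contDiffOn.smul
    hs.contDiffOn_formA).sub
    ((by fun_prop : ContDiff ℝ ∞ fun p : R4 => Real.cosh (2 * a * p 2)).contDiffOn.smul
    hs.contDiffOn_formP)

theorem contDiffOn_theta4 (hs : IsSolution a U h H) : ContDiffOn ℝ ∞ (theta4 a H) (domain U) := by
  rw [theta4_eq]
  exact contDiffOn_const.sub hs.contDiffOn_formQ

theorem contDiffOn_conformalFactor (hs : IsSolution a U h H) :
    ContDiffOn ℝ ∞ (fun p : R4 => Real.cosh (a * p 2) * h (p 0, p 1)) (domain U) :=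
  (by fun_prop : ContDiff ℝ ∞ fun p : R4 => Real.cosh (a * p 2)).contDiffOn.mul
    (contDiffOn_pullback hs.h_smooth)

theorem contDiffOn_theta1 (hs : IsSolution a U h H) : ContDiffOn ℝ ∞ (theta1 a h) (domain U) :=
  contDiffOn_dcoord_smul hs.contDiffOn_conformalFactor 0

theorem contDiffOn_theta2 (hs : IsSolution a U h H) : ContDiffOn ℝ ∞ (theta2 a h) (domain U) :=
  contDiffOn_dcoord_smul hs.contDiffOn_conformalFactor 1

theorem contDiffOn_starDlog (hs : IsSolution a U h H) :
    ContDiffOn ℝ ∞ (starDlog h) (domain U) :=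
  (contDiffOn_dcoord_smul (contDiffOn_pullback (contDiffOn_partialX hs.isOpen hs.logh_smooth)) 1).sub
    (contDiffOn_dcoord_smul (contDiffOn_pullback (contDiffOn_partialY hs.isOpen hs.logh_smooth)) 0)

theorem hasFDerivAt_pullback (hs : IsSolution a U h H) {F : ℝ × ℝ → ℝ} (hF : ContDiffOn ℝ ∞ F U)
    {p : R4} (hp : p ∈ domain U) :
    HasFDerivAt (fun q : R4 => F (q 0, q 1))
      (partialX F (p 0, p 1) • dcoord 0 + partialY F (p 0, p 1) • dcoord 1) p :=
  KahlerSurface.hasFDerivAt_pullback (differentiableAt_of_mem hs.isOpen hF hp.1)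

/-- The functions l₂, n₂ encode d ln H, up to the factor 2a and a rotation; in this form the
derivatives of H combine with those of e^{2iat} into `formA`. -/
theorem hasFDerivAt_H (hs : IsSolution a U h H) {p : R4} (hp : p ∈ domain U) :
    HasFDerivAt (fun q : R4 => H (q 0, q 1))
      ((2 * a * H (p 0, p 1)) • (n2 a H (p 0, p 1) • dcoord 0 - l2 a H (p 0, p 1) • dcoord 1)) p := by
  refine (hs.hasFDerivAt_pullback hs.H_smooth hp).congr_fderiv ?_
  have hd := differentiableAt_of_mem hs.isOpen hs.H_smooth hp.1
  have h0 := (hs.H_pos _ hp.1).ne'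
  have ha := hs.ne_zero
  rw [partialX_eq_mul_log hd h0, partialY_eq_mul_log hd h0]
  ext X
  simp [l2, n2, dcoord_apply]
  field_simp

theorem hasFDerivAt_h (hs : IsSolution a U h H) {p : R4} (hp : p ∈ domain U) :
    HasFDerivAt (fun q : R4 => h (q 0, q 1))
      (h (p 0, p 1) • (partialX (fun r => Real.log (h r)) (p 0, p 1) • dcoord 0
        + partialY (fun r => Real.log (h r)) (p 0, p 1) • dcoord 1)) p := by
  refine (hs.hasFDerivAt_pullback hs.h_smooth hp).congr_fderiv ?_
  have hd := differentiableAt_of_mem hs.isOpen hs.h_smooth hp.1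
  have h0 := (hs.h_pos _ hp.1).ne'
  rw [partialX_eq_mul_log hd h0, partialY_eq_mul_log hd h0]
  ext X
  simp [dcoord_apply]
  ring

/-! ### Exterior derivatives -/

variable {p : R4}

/-- Real part of d(P + iQ) = 2ia A ∧ (P + iQ): on dx + i dy, wedging with d ln H is the same as
wedging with -2ia(l₂ dx + n₂ dy). -/
theorem extOne_formP (hs : IsSolution a U h H) (hp : p ∈ domain U) (X Y : R4) :
    extOne (formP a H) p X Y
      = -2 * a * (formA a H p X * formQ a H p Y - formA a H p Y * formQ a H p X) := by
  have h1 := (hasFDerivAt_cos (2 * a) 3 p).mul (hs.hasFDerivAt_H hp)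
  have h2 := (hasFDerivAt_sin (2 * a) 3 p).mul (hs.hasFDerivAt_H hp)
  have h3 := extOne_sub (h1.differentiableAt.smul_const (dcoord 0))
    (h2.differentiableAt.smul_const (dcoord 1)) X Y
  refine h3.trans ?_
  rw [extOne_dcoord_smul h1, extOne_dcoord_smul h2]
  simp [formA, formQ, dcoord_apply]
  ring

theorem extOne_formQ (hs : IsSolution a U h H) (hp : p ∈ domain U) (X Y : R4) :
    extOne (formQ a H) p X Y
      = 2 * a * (formA a H p X * formP a H p Y - formA a H p Y * formP a H p X) := by
  have h1 := (hasFDerivAt_cos (2 * a) 3 p).mul (hs.hasFDerivAt_H hp)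
  have h2 := (hasFDerivAt_sin (2 * a) 3 p).mul (hs.hasFDerivAt_H hp)
  have h3 := extOne_add (h2.differentiableAt.smul_const (dcoord 0))
    (h1.differentiableAt.smul_const (dcoord 1)) X Y
  refine h3.trans ?_
  rw [extOne_dcoord_smul h1, extOne_dcoord_smul h2]
  simp [formA, formP, dcoord_apply]
  ring

theorem laplacian_log_eq (hs : IsSolution a U h H) {q : ℝ × ℝ} (hq : q ∈ U) :
    partialX (n2 a H) q - partialY (l2 a H) q = -a * h q ^ 2 + 2 * a * H q ^ 2 := by
  have h1 := differentiableAt_of_mem hs.isOpen (contDiffOn_partialX hs.isOpen hs.logH_smooth) hq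
  have h2 := differentiableAt_of_mem hs.isOpen (contDiffOn_partialY hs.isOpen hs.logH_smooth) hq
  have h3 := hs.laplacian_eq q hq
  have ha := hs.ne_zero
  have h4 : partialX (n2 a H) q
      = 1 / (2 * a) * partialX (partialX fun r => Real.log (H r)) q := by
    unfold n2
    rw [partialX, fderiv_const_mul h1]
    rfl
  have h5 : partialY (l2 a H) q
      = -(1 / (2 * a)) * partialY (partialY fun r => Real.log (H r)) q := by
    unfold l2
    rw [partialY, fderiv_const_mul h2]
    rfl
  rw [laplacian2] at h3
  rw [h4, h5]
  field_simp
  linear_combination h3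

/-- The differential equation for H enters the structure equations and the curvature only through
this formula. -/
theorem extOne_formA (hs : IsSolution a U h H) (hp : p ∈ domain U) (X Y : R4) :
    extOne (formA a H) p X Y
      = (a * h (p 0, p 1) ^ 2 - 2 * a * H (p 0, p 1) ^ 2) * (X 0 * Y 1 - X 1 * Y 0) := by
  have h1 := hs.hasFDerivAt_pullback hs.contDiffOn_l2 hp
  have h2 := hs.hasFDerivAt_pullback hs.contDiffOn_n2 hp
  have h3 := extOne_sub ((differentiableAt_const (dcoord 3)).sub
    (h1.differentiableAt.smul_const (dcoord 0))) (h2.differentiableAt.smul_const (dcoord 1)) X Y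
  have h4 := extOne_sub (differentiableAt_const (dcoord 3) (x := p))
    (h1.differentiableAt.smul_const (dcoord 0)) X Y
  refine h3.trans ?_
  refine (congrArg (· - _) h4).trans ?_
  rw [extOne_dcoord_smul h1, extOne_dcoord_smul h2, extOne_const]
  simp [dcoord_apply]
  linear_combination (X 1 * Y 0 - X 0 * Y 1) * hs.laplacian_log_eq hp.1

/-- The Laplacian of ln h is not constrained; it ends up in `horizontalCurvature`. -/
theorem extOne_starDlog (hs : IsSolution a U h H) (hp : p ∈ domain U) (X Y : R4) :
    extOne (starDlog h) p X Y
      = laplacian2 (fun r => Real.log (h r)) (p 0, p 1) * (X 0 * Y 1 - X 1 * Y 0) := by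
  have h1 := hs.hasFDerivAt_pullback (contDiffOn_partialX hs.isOpen hs.logh_smooth) hp
  have h2 := hs.hasFDerivAt_pullback (contDiffOn_partialY hs.isOpen hs.logh_smooth) hp
  have h3 := extOne_sub (h1.differentiableAt.smul_const (dcoord 1))
    (h2.differentiableAt.smul_const (dcoord 0)) X Y
  refine h3.trans ?_
  rw [extOne_dcoord_smul h1, extOne_dcoord_smul h2]
  simp [dcoord_apply, laplacian2]
  ring

theorem extOne_theta4 (hs : IsSolution a U h H) (hp : p ∈ domain U) (X Y : R4) :
    extOne (theta4 a H) p X Y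
      = -2 * a * (formA a H p X * formP a H p Y - formA a H p Y * formP a H p X) := by
  rw [theta4_eq, extOne_sub (differentiableAt_const _)
    (differentiableAt_of_mem (isOpen_domain hs.isOpen) hs.contDiffOn_formQ hp), extOne_const,
    hs.extOne_formQ hp]
  ring

/-- Differentiating the hyperbolic rotation in z turns θ₃ into 2aB; the same derivative turns B into
2aθ₃. -/
theorem extOne_theta3 (hs : IsSolution a U h H) (hp : p ∈ domain U) (X Y : R4) :
    extOne (theta3 a H) p X Y
      = 2 * a * (X 2 * formB a H p Y - Y 2 * formB a H p X)
        + Real.sinh (2 * a * p 2) * extOne (formA a H) p X Y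
        - Real.cosh (2 * a * p 2) * extOne (formP a H) p X Y := by
  have h1 := hasFDerivAt_sinh (2 * a) 2 p
  have h2 := hasFDerivAt_cosh (2 * a) 2 p
  have hA := differentiableAt_of_mem (isOpen_domain hs.isOpen) hs.contDiffOn_formA hp
  have hP := differentiableAt_of_mem (isOpen_domain hs.isOpen) hs.contDiffOn_formP hp
  rw [theta3_eq, extOne_sub (h1.differentiableAt.fun_smul hA) (h2.differentiableAt.fun_smul hP),
    extOne_smul h1.differentiableAt hA, extOne_smul h2.differentiableAt hP, h1.fderiv, h2.fderiv]
  simp [formB, dcoord_apply]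
  ring

theorem extOne_formB (hs : IsSolution a U h H) (hp : p ∈ domain U) (X Y : R4) :
    extOne (formB a H) p X Y
      = 2 * a * (X 2 * theta3 a H p Y - Y 2 * theta3 a H p X)
        + Real.cosh (2 * a * p 2) * extOne (formA a H) p X Y
        - Real.sinh (2 * a * p 2) * extOne (formP a H) p X Y := by
  have h1 := hasFDerivAt_sinh (2 * a) 2 p
  have h2 := hasFDerivAt_cosh (2 * a) 2 p
  have hA := differentiableAt_of_mem (isOpen_domain hs.isOpen) hs.contDiffOn_formA hp
  have hP := differentiableAt_of_mem (isOpen_domain hs.isOpen) hs.contDiffOn_formP hp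
  unfold formB
  rw [extOne_sub (h2.differentiableAt.fun_smul hA) (h1.differentiableAt.fun_smul hP),
    extOne_smul h2.differentiableAt hA, extOne_smul h1.differentiableAt hP, h1.fderiv, h2.fderiv]
  simp [theta3_eq, dcoord_apply]
  ring

theorem hasFDerivAt_conformalFactor (hs : IsSolution a U h H) (hp : p ∈ domain U) :
    HasFDerivAt (fun q : R4 => Real.cosh (a * q 2) * h (q 0, q 1))
      ((Real.cosh (a * p 2) * h (p 0, p 1)) • dlogFactor a h p) p := by
  refine ((hasFDerivAt_cosh a 2 p).mul (hs.hasFDerivAt_h hp)).congr_fderiv ?_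
  have := (Real.cosh_pos (a * p 2)).ne'
  ext X
  simp [dlogFactor, dcoord_apply, Real.tanh_eq_sinh_div_cosh]
  field_simp
  ring

theorem extOne_theta1 (hs : IsSolution a U h H) (hp : p ∈ domain U) (X Y : R4) :
    extOne (theta1 a h) p X Y
      = dlogFactor a h p X * theta1 a h p Y - dlogFactor a h p Y * theta1 a h p X := by
  refine (extOne_dcoord_smul (hs.hasFDerivAt_conformalFactor hp) 0 X Y).trans ?_
  simp [theta1, dcoord_apply]
  ring

theorem extOne_theta2 (hs : IsSolution a U h H) (hp : p ∈ domain U) (X Y : R4) :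
    extOne (theta2 a h) p X Y
      = dlogFactor a h p X * theta2 a h p Y - dlogFactor a h p Y * theta2 a h p X := by
  refine (extOne_dcoord_smul (hs.hasFDerivAt_conformalFactor hp) 1 X Y).trans ?_
  simp [theta2, dcoord_apply]
  ring

end IsSolution

end Data

/-! ### The orthonormal coframe, its structure equations and its connection form. -/

section Coframe

variable {U : Set (ℝ × ℝ)} {a : ℝ} {h H : ℝ × ℝ → ℝ} {p : R4}

/-- The skew endomorphisms which commute with `blockEnd (-1)`. -/
def unitaryEnd (k l m n : ℝ) : R4 →L[ℝ] R4 :=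
  LinearMap.toContinuousLinearMap
    { toFun := fun u => ![k * u 1 - n * u 2 + m * u 3, -(k * u 0) + m * u 2 + n * u 3,
        n * u 0 - m * u 1 + l * u 3, -(m * u 0) - n * u 1 - l * u 2]
      map_add' := fun u v => by ext i; fin_cases i <;> simp <;> ring
      map_smul' := fun c u => by ext i; fin_cases i <;> simp <;> ring }

theorem unitaryEnd_apply (k l m n : ℝ) (u : R4) :
    unitaryEnd k l m n u = ![k * u 1 - n * u 2 + m * u 3, -(k * u 0) + m * u 2 + n * u 3,
        n * u 0 - m * u 1 + l * u 3, -(m * u 0) - n * u 1 - l * u 2] := rfl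

theorem unitaryEnd_eq (k l m n : ℝ) : unitaryEnd k l m n
    = k • unitaryEnd 1 0 0 0 + l • unitaryEnd 0 1 0 0 + m • unitaryEnd 0 0 1 0
      + n • unitaryEnd 0 0 0 1 := by
  ext u i
  fin_cases i <;> simp [unitaryEnd_apply] <;> ring

/-- The orthonormal coframe `(θ₁, θ₂, θ₃, θ₄)`. -/
def coframe (a : ℝ) (h H : ℝ × ℝ → ℝ) (p : R4) : R4 →L[ℝ] R4 :=
  (theta1 a h p).smulRight (Pi.single 0 1) + (theta2 a h p).smulRight (Pi.single 1 1)
    + (theta3 a H p).smulRight (Pi.single 2 1) + (theta4 a H p).smulRight (Pi.single 3 1)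

theorem smul_single_four (c₀ c₁ c₂ c₃ : ℝ) :
    c₀ • (Pi.single 0 1 : R4) + c₁ • (Pi.single 1 1 : R4) + c₂ • (Pi.single 2 1 : R4)
      + c₃ • (Pi.single 3 1 : R4) = ![c₀, c₁, c₂, c₃] := by
  ext i
  fin_cases i <;> simp

theorem coframe_apply (X : R4) :
    coframe a h H p X = ![theta1 a h p X, theta2 a h p X, theta3 a H p X, theta4 a H p X] := by
  rw [← smul_single_four]
  rfl

/-- The connection form `ω₁₂`. -/
def connectionHorizontal (a : ℝ) (h H : ℝ × ℝ → ℝ) (p : R4) : R4 →L[ℝ] ℝ :=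
  (a * Real.tanh (a * p 2)) • (formP a H p - theta3 a H p) - starDlog h p

/-- The connection form `ω₃₄`. -/
def connectionVertical (a : ℝ) (H : ℝ × ℝ → ℝ) (p : R4) : R4 →L[ℝ] ℝ := (2 * a) • formB a H p

/-- The connection form `ω₁₄ = ω₂₃`. -/
def connectionMixed (a : ℝ) (h : ℝ × ℝ → ℝ) (p : R4) : R4 →L[ℝ] ℝ :=
  (a * Real.tanh (a * p 2)) • theta1 a h p

/-- The connection form `ω₂₄ = -ω₁₃`. -/
def connectionMixed' (a : ℝ) (h : ℝ × ℝ → ℝ) (p : R4) : R4 →L[ℝ] ℝ :=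
  (a * Real.tanh (a * p 2)) • theta2 a h p

/-- The connection form of the coframe. -/
def connection (a : ℝ) (h H : ℝ × ℝ → ℝ) (p : R4) : R4 →L[ℝ] R4 →L[ℝ] R4 :=
  (connectionHorizontal a h H p).smulRight (unitaryEnd 1 0 0 0)
    + (connectionVertical a H p).smulRight (unitaryEnd 0 1 0 0)
    + (connectionMixed a h p).smulRight (unitaryEnd 0 0 1 0)
    + (connectionMixed' a h p).smulRight (unitaryEnd 0 0 0 1)

theorem connection_apply (X : R4) :
    connection a h H p X = unitaryEnd (connectionHorizontal a h H p X) (connectionVertical a H p X)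
      (connectionMixed a h p X) (connectionMixed' a h p X) := by
  rw [unitaryEnd_eq]
  rfl

theorem theta1_apply (X : R4) :
    theta1 a h p X = Real.cosh (a * p 2) * h (p 0, p 1) * X 0 := rfl

theorem theta2_apply (X : R4) :
    theta2 a h p X = Real.cosh (a * p 2) * h (p 0, p 1) * X 1 := rfl

theorem theta4_apply (X : R4) : theta4 a H p X = X 2 - formQ a H p X := by
  rw [theta4_eq]
  rfl

theorem theta3_apply (X : R4) :
    theta3 a H p X = 2 * Real.sinh (a * p 2) * Real.cosh (a * p 2) * formA a H p X
      - (Real.cosh (a * p 2) ^ 2 + Real.sinh (a * p 2) ^ 2) * formP a H p X := by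
  rw [theta3_eq]
  beta_reduce
  rw [mul_assoc 2 a (p 2), ← Real.sinh_two_mul, ← Real.cosh_two_mul]
  rfl

theorem formB_apply (X : R4) :
    formB a H p X = (Real.cosh (a * p 2) ^ 2 + Real.sinh (a * p 2) ^ 2) * formA a H p X
      - 2 * Real.sinh (a * p 2) * Real.cosh (a * p 2) * formP a H p X := by
  rw [← Real.sinh_two_mul, ← Real.cosh_two_mul, ← mul_assoc 2 a (p 2)]
  rfl

theorem formP_apply (X : R4) : formP a H p X
    = H (p 0, p 1) * (Real.cos (2 * a * p 3) * X 0 - Real.sin (2 * a * p 3) * X 1) := by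
  simp [formP, dcoord_apply]
  ring

theorem formQ_apply (X : R4) : formQ a H p X
    = H (p 0, p 1) * (Real.sin (2 * a * p 3) * X 0 + Real.cos (2 * a * p 3) * X 1) := by
  simp [formQ, dcoord_apply]
  ring

/-- P, Q arise from dx, dy by a rotation, up to sign conventions, and a scaling by H, so P ∧ Q = H²
dx ∧ dy. -/
theorem formP_wedge_formQ (X Y : R4) :
    formP a H p X * formQ a H p Y - formP a H p Y * formQ a H p X
      = H (p 0, p 1) ^ 2 * (X 0 * Y 1 - X 1 * Y 0) := by
  simp only [formP_apply, formQ_apply]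
  linear_combination (H (p 0, p 1) ^ 2 * (X 0 * Y 1 - X 1 * Y 0))
    * Real.sin_sq_add_cos_sq (2 * a * p 3)

theorem dlogFactor_apply (X : R4) : dlogFactor a h p X
    = a * Real.tanh (a * p 2) * X 2 + (partialX (fun r => Real.log (h r)) (p 0, p 1) * X 0
      + partialY (fun r => Real.log (h r)) (p 0, p 1) * X 1) := rfl

theorem starDlog_apply (X : R4) : starDlog h p X
    = partialX (fun r => Real.log (h r)) (p 0, p 1) * X 1
      - partialY (fun r => Real.log (h r)) (p 0, p 1) * X 0 := rfl

theorem metric_apply (X Y : R4) :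
    metric a h H p X Y = coframe a h H p X ⬝ᵥ coframe a h H p Y := by
  rw [dotProduct_four, coframe_apply, coframe_apply]
  simp [metric, gSigma, sqForm, theta1, theta2]
  ring

namespace IsSolution

/-- This is where z < 0 matters: sinh 2az is the only coefficient of dt in the coframe. -/
theorem sinh_ne_zero (hs : IsSolution a U h H) (hp : p ∈ domain U) : Real.sinh (a * p 2) ≠ 0 := by
  rw [Ne, Real.sinh_eq_zero]
  exact mul_ne_zero hs.ne_zero hp.2.ne

theorem contDiffOn_coframe (hs : IsSolution a U h H) :
    ContDiffOn ℝ ∞ (coframe a h H) (domain U) :=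
  (((hs.contDiffOn_theta1.smulRight contDiffOn_const).add
    (hs.contDiffOn_theta2.smulRight contDiffOn_const)).add
    (hs.contDiffOn_theta3.smulRight contDiffOn_const)).add
    (hs.contDiffOn_theta4.smulRight contDiffOn_const)

theorem coframe_injective (hs : IsSolution a U h H) (hp : p ∈ domain U) :
    Function.Injective (coframe a h H p) := by
  rw [injective_iff_map_eq_zero]
  intro X hX
  have hh := (hs.h_pos _ hp.1).ne'
  have hc := (Real.cosh_pos (a * p 2)).ne'
  have hsn := hs.sinh_ne_zero hp
  rw [coframe_apply] at hX
  have e0 : theta1 a h p X = 0 := congrFun hX 0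
  have e1 : theta2 a h p X = 0 := congrFun hX 1
  have e2 : theta3 a H p X = 0 := congrFun hX 2
  have e3 : theta4 a H p X = 0 := congrFun hX 3
  have x0 : X 0 = 0 := by simpa [theta1_apply, hh, hc] using e0
  have x1 : X 1 = 0 := by simpa [theta2_apply, hh, hc] using e1
  have x2 : X 2 = 0 := by simpa [theta4_apply, formQ_apply, x0, x1] using e3
  have x3 : X 3 = 0 := by
    simpa [theta3_apply, formP_apply, formA, dcoord_apply, x0, x1, hc, hsn] using e2
  ext i
  fin_cases i <;> assumption

theorem coframe_isInvertible (hs : IsSolution a U h H) (hp : p ∈ domain U) :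
    (coframe a h H p).IsInvertible :=
  ⟨(LinearEquiv.ofInjectiveEndo (coframe a h H p).toLinearMap
    (hs.coframe_injective hp)).toContinuousLinearEquiv, by ext1; rfl⟩

theorem isRiemannianMetric (hs : IsSolution a U h H) :
    IsRiemannianMetric (domain U) (metric a h H) where
  smooth := by
    have h0 : metric a h H = fun p => sqForm (theta1 a h p) + sqForm (theta2 a h p)
        + sqForm (theta3 a H p) + sqForm (theta4 a H p) := by
      ext p X Y
      simp [metric, gSigma, sqForm, theta1, theta2]
      ring
    have h1 : ContDiffOn ℝ ∞ (fun p => sqForm (theta1 a h p)) (domain U) :=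
      hs.contDiffOn_theta1.smulRight hs.contDiffOn_theta1
    have h2 : ContDiffOn ℝ ∞ (fun p => sqForm (theta2 a h p)) (domain U) :=
      hs.contDiffOn_theta2.smulRight hs.contDiffOn_theta2
    have h3 : ContDiffOn ℝ ∞ (fun p => sqForm (theta3 a H p)) (domain U) :=
      hs.contDiffOn_theta3.smulRight hs.contDiffOn_theta3
    have h4 : ContDiffOn ℝ ∞ (fun p => sqForm (theta4 a H p)) (domain U) :=
      hs.contDiffOn_theta4.smulRight hs.contDiffOn_theta4
    rw [h0]
    exact ((h1.add h2).add h3).add h4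
  symm p _ X Y := by rw [metric_apply, metric_apply, dotProduct_comm]
  pos p hp X hX := by
    rw [metric_apply]
    have h1 : coframe a h H p X ≠ 0 := fun h0 =>
      hX ((injective_iff_map_eq_zero _).1 (hs.coframe_injective hp) X h0)
    exact lt_of_le_of_ne (by simp only [dotProduct_four, ← sq]; positivity)
      fun h0 => h1 (dotProduct_self_eq_zero.1 h0.symm)

theorem contDiffOn_tanh (s : Set R4) :
    ContDiffOn ℝ ∞ (fun p : R4 => a * Real.tanh (a * p 2)) s := by
  simp only [Real.tanh_eq_sinh_div_cosh]
  exact ContDiff.contDiffOn (contDiff_const.mul (ContDiff.div (by fun_prop) (by fun_prop)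
    fun p => (Real.cosh_pos _).ne'))

theorem contDiffOn_connectionHorizontal (hs : IsSolution a U h H) :
    ContDiffOn ℝ ∞ (connectionHorizontal a h H) (domain U) :=
  ((contDiffOn_tanh _).smul (hs.contDiffOn_formP.sub hs.contDiffOn_theta3)).sub
    hs.contDiffOn_starDlog

theorem contDiffOn_connectionVertical (hs : IsSolution a U h H) :
    ContDiffOn ℝ ∞ (connectionVertical a H) (domain U) :=
  (contDiffOn_const (c := 2 * a)).smul hs.contDiffOn_formB

theorem contDiffOn_connectionMixed (hs : IsSolution a U h H) :
    ContDiffOn ℝ ∞ (connectionMixed a h) (domain U) :=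
  (contDiffOn_tanh _).smul hs.contDiffOn_theta1

theorem contDiffOn_connectionMixed' (hs : IsSolution a U h H) :
    ContDiffOn ℝ ∞ (connectionMixed' a h) (domain U) :=
  (contDiffOn_tanh _).smul hs.contDiffOn_theta2

theorem contDiffOn_connection (hs : IsSolution a U h H) :
    ContDiffOn ℝ ∞ (connection a h H) (domain U) :=
  (((hs.contDiffOn_connectionHorizontal.smulRight contDiffOn_const).add
    (hs.contDiffOn_connectionVertical.smulRight contDiffOn_const)).add
    (hs.contDiffOn_connectionMixed.smulRight contDiffOn_const)).add
    (hs.contDiffOn_connectionMixed'.smulRight contDiffOn_const)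

theorem differentiableAt (hs : IsSolution a U h H) (hp : p ∈ domain U) {F : Type*}
    [NormedAddCommGroup F] [NormedSpace ℝ F] {f : R4 → F} (hf : ContDiffOn ℝ ∞ f (domain U)) :
    DifferentiableAt ℝ f p := differentiableAt_of_mem (isOpen_domain hs.isOpen) hf hp

theorem extOne_coframe (hs : IsSolution a U h H) (hp : p ∈ domain U) (X Y : R4) :
    extOne (coframe a h H) p X Y = ![extOne (theta1 a h) p X Y, extOne (theta2 a h) p X Y,
      extOne (theta3 a H) p X Y, extOne (theta4 a H) p X Y] := by
  have h1 := hs.differentiableAt hp hs.contDiffOn_theta1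
  have h2 := hs.differentiableAt hp hs.contDiffOn_theta2
  have h3 := hs.differentiableAt hp hs.contDiffOn_theta3
  have h4 := hs.differentiableAt hp hs.contDiffOn_theta4
  have s1 := hs.differentiableAt hp
    (hs.contDiffOn_theta1.smulRight (contDiffOn_const (c := (Pi.single 0 1 : R4))))
  have s2 := hs.differentiableAt hp
    (hs.contDiffOn_theta2.smulRight (contDiffOn_const (c := (Pi.single 1 1 : R4))))
  have s3 := hs.differentiableAt hp
    (hs.contDiffOn_theta3.smulRight (contDiffOn_const (c := (Pi.single 2 1 : R4))))
  have s4 := hs.differentiableAt hp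
    (hs.contDiffOn_theta4.smulRight (contDiffOn_const (c := (Pi.single 3 1 : R4))))
  unfold coframe
  rw [extOne_add ((s1.fun_add s2).fun_add s3) s4, extOne_add (s1.fun_add s2) s3, extOne_add s1 s2,
    extOne_smulRight h1, extOne_smulRight h2, extOne_smulRight h3, extOne_smulRight h4,
    smul_single_four]

theorem extOne_connection (hs : IsSolution a U h H) (hp : p ∈ domain U) (X Y : R4) :
    extOne (connection a h H) p X Y
      = unitaryEnd (extOne (connectionHorizontal a h H) p X Y)
        (extOne (connectionVertical a H) p X Y) (extOne (connectionMixed a h) p X Y)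
        (extOne (connectionMixed' a h) p X Y) := by
  have h1 := hs.differentiableAt hp hs.contDiffOn_connectionHorizontal
  have h2 := hs.differentiableAt hp hs.contDiffOn_connectionVertical
  have h3 := hs.differentiableAt hp hs.contDiffOn_connectionMixed
  have h4 := hs.differentiableAt hp hs.contDiffOn_connectionMixed'
  have s1 := hs.differentiableAt hp
    (hs.contDiffOn_connectionHorizontal.smulRight (contDiffOn_const (c := unitaryEnd 1 0 0 0)))
  have s2 := hs.differentiableAt hp
    (hs.contDiffOn_connectionVertical.smulRight (contDiffOn_const (c := unitaryEnd 0 1 0 0)))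
  have s3 := hs.differentiableAt hp
    (hs.contDiffOn_connectionMixed.smulRight (contDiffOn_const (c := unitaryEnd 0 0 1 0)))
  have s4 := hs.differentiableAt hp
    (hs.contDiffOn_connectionMixed'.smulRight (contDiffOn_const (c := unitaryEnd 0 0 0 1)))
  unfold connection
  rw [extOne_add ((s1.fun_add s2).fun_add s3) s4, extOne_add (s1.fun_add s2) s3, extOne_add s1 s2,
    extOne_smulRight h1, extOne_smulRight h2, extOne_smulRight h3, extOne_smulRight h4,
    ← unitaryEnd_eq]

/-- `dθ₃ = 2a θ₄ ∧ B + 2a tanh az θ₁ ∧ θ₂`. -/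
theorem extOne_theta3_eq (hs : IsSolution a U h H) (hp : p ∈ domain U) (X Y : R4) :
    extOne (theta3 a H) p X Y
      = 2 * a * (theta4 a H p X * formB a H p Y - theta4 a H p Y * formB a H p X)
        + 2 * (a * Real.tanh (a * p 2)) * (theta1 a h p X * theta2 a h p Y
          - theta1 a h p Y * theta2 a h p X) := by
  have hPQ := formP_wedge_formQ (a := a) (H := H) (p := p) X Y
  have hc := (Real.cosh_pos (a * p 2)).ne'
  rw [hs.extOne_theta3 hp, hs.extOne_formA hp, hs.extOne_formP hp, mul_assoc 2 a (p 2),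
    Real.sinh_two_mul, Real.cosh_two_mul, Real.tanh_eq_sinh_div_cosh]
  simp only [theta4_apply, formB_apply, theta1_apply, theta2_apply]
  field_simp
  -- The H² term of dA cancels against the P ∧ Q part of θ₄ ∧ B; the h² term becomes the multiple of
  -- θ₁ ∧ θ₂.
  linear_combination (2 * a * Real.sinh (a * p 2) * Real.cosh (a * p 2)) * hPQ

/-- `dθ₄ = -2a θ₃ ∧ B`. -/
theorem extOne_theta4_eq (hs : IsSolution a U h H) (hp : p ∈ domain U) (X Y : R4) :
    extOne (theta4 a H) p X Y
      = -2 * a * (theta3 a H p X * formB a H p Y - theta3 a H p Y * formB a H p X) := by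
  rw [hs.extOne_theta4 hp]
  -- A hyperbolic rotation preserves area up to sign: here θ₃ ∧ B = A ∧ P.
  simp only [theta3_apply, formB_apply, Real.cosh_sq (a * p 2)]
  ring_nf
  rw [show Real.cosh (a * p 2) ^ 2 = Real.sinh (a * p 2) ^ 2 + 1 from Real.cosh_sq _]
  ring

theorem isConnectionForm (hs : IsSolution a U h H) :
    IsConnectionForm (domain U) (coframe a h H) (connection a h H) where
  smooth := hs.contDiffOn_connection
  skew p _ X u v := by
    rw [connection_apply, dotProduct_four, dotProduct_four]
    simp [unitaryEnd_apply]
    ring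
  torsion p hp X Y := by
    rw [hs.extOne_coframe hp, hs.extOne_theta1 hp, hs.extOne_theta2 hp, hs.extOne_theta3_eq hp,
      hs.extOne_theta4_eq hp, connection_apply, connection_apply, unitaryEnd_apply,
      unitaryEnd_apply, coframe_apply, coframe_apply]
    ext i
    fin_cases i
    · simp [connectionHorizontal, connectionVertical, connectionMixed, connectionMixed']
      -- The P in ω₁₂ compensates the Q in θ₄, since θ₁ ∧ Q = P ∧ θ₂; the θ₃ in ω₁₂ cancels the
      -- contribution of ω₁₃.
      simp only [dlogFactor_apply, starDlog_apply, theta4_apply, formQ_apply, formP_apply,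
        theta1_apply, theta2_apply]
      ring
    · simp [connectionHorizontal, connectionVertical, connectionMixed, connectionMixed']
      simp only [dlogFactor_apply, starDlog_apply, theta4_apply, formQ_apply, formP_apply,
        theta1_apply, theta2_apply]
      ring
    · simp [connectionHorizontal, connectionVertical, connectionMixed, connectionMixed']
      ring
    · simp [connectionHorizontal, connectionVertical, connectionMixed, connectionMixed']
      ring

end IsSolution

end Coframe

/-! ### The curvature of the connection form. -/

section Curvature

variable {U : Set (ℝ × ℝ)} {a : ℝ} {h H : ℝ × ℝ → ℝ} {p : R4}

/-- The sectional curvature of the horizontal planes. -/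
def horizontalCurvature (a : ℝ) (h H : ℝ × ℝ → ℝ) (p : R4) : ℝ :=
  -(2 * a ^ 2 * H (p 0, p 1) ^ 2 + laplacian2 (fun r => Real.log (h r)) (p 0, p 1))
    / (Real.cosh (a * p 2) * h (p 0, p 1)) ^ 2 - 4 * a ^ 2 * Real.tanh (a * p 2) ^ 2

namespace IsSolution

theorem extOne_connectionHorizontal (hs : IsSolution a U h H) (hp : p ∈ domain U) (X Y : R4) :
    extOne (connectionHorizontal a h H) p X Y
      = a ^ 2 / Real.cosh (a * p 2) ^ 2 * (X 2 * (formP a H p Y - theta3 a H p Y)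
          - Y 2 * (formP a H p X - theta3 a H p X))
        + a * Real.tanh (a * p 2) * (extOne (formP a H) p X Y - extOne (theta3 a H) p X Y)
        - extOne (starDlog h) p X Y := by
  have h1 := hasFDerivAt_tanh a 2 p
  have h2 := hs.differentiableAt hp hs.contDiffOn_formP
  have h3 := hs.differentiableAt hp hs.contDiffOn_theta3
  have h4 := hs.differentiableAt hp hs.contDiffOn_starDlog
  unfold connectionHorizontal
  rw [extOne_sub (h1.differentiableAt.fun_smul (h2.fun_sub h3)) h4,
    extOne_smul h1.differentiableAt (h2.fun_sub h3), extOne_sub h2 h3, h1.fderiv]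
  simp [dcoord_apply]
  ring

theorem extOne_connectionVertical (hs : IsSolution a U h H) (hp : p ∈ domain U) (X Y : R4) :
    extOne (connectionVertical a H) p X Y = 2 * a * extOne (formB a H) p X Y := by
  unfold connectionVertical
  rw [extOne_smul (differentiableAt_const _) (hs.differentiableAt hp hs.contDiffOn_formB)]
  simp

theorem extOne_connectionMixed (hs : IsSolution a U h H) (hp : p ∈ domain U) (X Y : R4) :
    extOne (connectionMixed a h) p X Y
      = a ^ 2 / Real.cosh (a * p 2) ^ 2 * (X 2 * theta1 a h p Y - Y 2 * theta1 a h p X)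
        + a * Real.tanh (a * p 2) * extOne (theta1 a h) p X Y := by
  have h1 := hasFDerivAt_tanh a 2 p
  unfold connectionMixed
  rw [extOne_smul h1.differentiableAt (hs.differentiableAt hp hs.contDiffOn_theta1), h1.fderiv]
  simp [dcoord_apply]
  ring

theorem extOne_connectionMixed' (hs : IsSolution a U h H) (hp : p ∈ domain U) (X Y : R4) :
    extOne (connectionMixed' a h) p X Y
      = a ^ 2 / Real.cosh (a * p 2) ^ 2 * (X 2 * theta2 a h p Y - Y 2 * theta2 a h p X)
        + a * Real.tanh (a * p 2) * extOne (theta2 a h) p X Y := by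
  have h1 := hasFDerivAt_tanh a 2 p
  unfold connectionMixed'
  rw [extOne_smul h1.differentiableAt (hs.differentiableAt hp hs.contDiffOn_theta2), h1.fderiv]
  simp [dcoord_apply]
  ring

/-- The component Ω₁₂ of the curvature; the quadratic term collects the products through the indices
3 and 4, which are equal. -/
theorem curvature_horizontal (hs : IsSolution a U h H) (hp : p ∈ domain U) (X Y : R4) :
    extOne (connectionHorizontal a h H) p X Y
      - 2 * (connectionMixed a h p X * connectionMixed' a h p Y
        - connectionMixed a h p Y * connectionMixed' a h p X)
      = horizontalCurvature a h H p * (theta1 a h p X * theta2 a h p Y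
          - theta2 a h p X * theta1 a h p Y)
        + 2 * a ^ 2 * (theta3 a H p X * theta4 a H p Y - theta4 a H p X * theta3 a H p Y) := by
  have hPQ := formP_wedge_formQ (a := a) (H := H) (p := p) X Y
  have hc := (Real.cosh_pos (a * p 2)).ne'
  have hh := (hs.h_pos _ hp.1).ne'
  have hsq := Real.sinh_sq (a * p 2)
  rw [hs.extOne_connectionHorizontal hp, hs.extOne_formP hp, hs.extOne_theta3_eq hp,
    hs.extOne_starDlog hp]
  simp only [horizontalCurvature, connectionMixed, connectionMixed', smul_apply, smul_eq_mul,
    theta4_apply, formB_apply, theta3_apply, theta1_apply, theta2_apply,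
    Real.tanh_eq_sinh_div_cosh]
  -- From here sinh and cosh are independent symbols tied only by `hsq`, which eliminates the powers
  -- of sinh.
  generalize Real.sinh (a * p 2) = sh at *
  generalize Real.cosh (a * p 2) = ch at *
  field_simp
  ring_nf
  simp only [hsq, show sh ^ 3 = sh * sh ^ 2 by ring]
  linear_combination (-2 * a ^ 2 * ch ^ 2) * hPQ

theorem curvature_vertical (hs : IsSolution a U h H) (hp : p ∈ domain U) (X Y : R4) :
    extOne (connectionVertical a H) p X Y
      - 2 * (connectionMixed a h p X * connectionMixed' a h p Y
        - connectionMixed a h p Y * connectionMixed' a h p X)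
      = 2 * a ^ 2 * (theta1 a h p X * theta2 a h p Y - theta2 a h p X * theta1 a h p Y)
        - 4 * a ^ 2 * (theta3 a H p X * theta4 a H p Y - theta4 a H p X * theta3 a H p Y) := by
  have hPQ := formP_wedge_formQ (a := a) (H := H) (p := p) X Y
  have hc := (Real.cosh_pos (a * p 2)).ne'
  have hsq := Real.sinh_sq (a * p 2)
  rw [hs.extOne_connectionVertical hp, hs.extOne_formB hp, hs.extOne_formP hp, hs.extOne_formA hp,
    mul_assoc 2 a (p 2), Real.sinh_two_mul, Real.cosh_two_mul]
  simp only [connectionMixed, connectionMixed', smul_apply, smul_eq_mul,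
    theta4_apply, theta3_apply, theta1_apply, theta2_apply, Real.tanh_eq_sinh_div_cosh]
  generalize Real.sinh (a * p 2) = sh at *
  generalize Real.cosh (a * p 2) = ch at *
  field_simp
  ring_nf
  simp only [hsq]
  linear_combination (8 * a ^ 2 * ch ^ 2 - 4 * a ^ 2) * hPQ

theorem curvature_mixed (hs : IsSolution a U h H) (hp : p ∈ domain U) (X Y : R4) :
    extOne (connectionMixed a h) p X Y
      + ((connectionHorizontal a h H p X + connectionVertical a H p X) * connectionMixed' a h p Y
      - (connectionHorizontal a h H p Y + connectionVertical a H p Y) * connectionMixed' a h p X)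
      = -a ^ 2 * ((theta1 a h p X * theta4 a H p Y - theta4 a H p X * theta1 a h p Y)
        + (theta2 a h p X * theta3 a H p Y - theta3 a H p X * theta2 a h p Y)) := by
  have hc := (Real.cosh_pos (a * p 2)).ne'
  have hsq := Real.sinh_sq (a * p 2)
  rw [hs.extOne_connectionMixed hp, hs.extOne_theta1 hp]
  simp only [connectionHorizontal, connectionVertical, connectionMixed', sub_apply,
    smul_apply, smul_eq_mul, dlogFactor_apply, starDlog_apply,
    theta4_apply, theta3_apply, theta1_apply, theta2_apply, formB_apply, formP_apply, formQ_apply,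
    Real.tanh_eq_sinh_div_cosh]
  generalize Real.sinh (a * p 2) = sh at *
  generalize Real.cosh (a * p 2) = ch at *
  field_simp
  ring_nf
  simp only [hsq, show sh ^ 4 = (sh ^ 2) ^ 2 by ring]
  ring

theorem curvature_mixed' (hs : IsSolution a U h H) (hp : p ∈ domain U) (X Y : R4) :
    extOne (connectionMixed' a h) p X Y
      - ((connectionHorizontal a h H p X + connectionVertical a H p X) * connectionMixed a h p Y
      - (connectionHorizontal a h H p Y + connectionVertical a H p Y) * connectionMixed a h p X)
      = -a ^ 2 * ((theta2 a h p X * theta4 a H p Y - theta4 a H p X * theta2 a h p Y)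
        - (theta1 a h p X * theta3 a H p Y - theta3 a H p X * theta1 a h p Y)) := by
  have hc := (Real.cosh_pos (a * p 2)).ne'
  have hsq := Real.sinh_sq (a * p 2)
  rw [hs.extOne_connectionMixed' hp, hs.extOne_theta2 hp]
  simp only [connectionHorizontal, connectionVertical, connectionMixed, sub_apply,
    smul_apply, smul_eq_mul, dlogFactor_apply, starDlog_apply,
    theta4_apply, theta3_apply, theta1_apply, theta2_apply, formB_apply, formP_apply, formQ_apply,
    Real.tanh_eq_sinh_div_cosh]
  generalize Real.sinh (a * p 2) = sh at *
  generalize Real.cosh (a * p 2) = ch at *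
  field_simp
  ring_nf
  simp only [hsq, show sh ^ 4 = (sh ^ 2) ^ 2 by ring]
  ring

/-- The curvature takes values in the skew endomorphisms commuting with J̄, so four scalar two-forms
determine it. -/
theorem curvatureForm_connection (hs : IsSolution a U h H) (hp : p ∈ domain U) (X Y u : R4) :
    curvatureForm (connection a h H) p X Y u
      = curvatureModel a (horizontalCurvature a h H p) (coframe a h H p X) (coframe a h H p Y) u := by
  have e1 := hs.curvature_horizontal hp X Y
  have e2 := hs.curvature_vertical hp X Y
  have e3 := hs.curvature_mixed hp X Y
  have e4 := hs.curvature_mixed' hp X Y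
  rw [curvatureForm, hs.extOne_connection hp, connection_apply, connection_apply, coframe_apply,
    coframe_apply]
  ext i
  fin_cases i
  · simp [unitaryEnd_apply, curvatureModel]
    linear_combination u 1 * e1 - u 2 * e4 + u 3 * e3
  · simp [unitaryEnd_apply, curvatureModel]
    linear_combination -u 0 * e1 + u 2 * e3 + u 3 * e4
  · simp [unitaryEnd_apply, curvatureModel]
    linear_combination u 0 * e4 - u 1 * e3 + u 3 * e2
  · simp [unitaryEnd_apply, curvatureModel]
    linear_combination -u 0 * e3 - u 1 * e4 - u 2 * e2

theorem coframe_riemann (hs : IsSolution a U h H) (hp : p ∈ domain U) (X Y Z : R4) :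
    coframe a h H p (riemann (metric a h H) p X Y Z)
      = curvatureModel a (horizontalCurvature a h H p) (coframe a h H p X) (coframe a h H p Y)
        (coframe a h H p Z) := by
  rw [KahlerSurface.coframe_riemann (isOpen_domain hs.isOpen) hs.contDiffOn_coframe
    (fun p hp => hs.coframe_isInvertible hp) hs.isRiemannianMetric
    (fun p _ X Y => metric_apply X Y) hs.isConnectionForm hp, hs.curvatureForm_connection hp]

end IsSolution

end Curvature

/-! ### The two complex structures, their Kähler forms and the Lee form. -/

section Structures

variable {U : Set (ℝ × ℝ)} {a : ℝ} {h H : ℝ × ℝ → ℝ} {p : R4}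

theorem omega_eq : omega a h H = fun p =>
    wedge (theta1 a h p) (theta2 a h p) + wedge (theta3 a H p) (theta4 a H p) := by
  funext p
  refine alt2_ext fun X Y => ?_
  simp [omega, omegaSigma, wedge_apply, theta1_apply, theta2_apply, dcoord_apply]
  ring

theorem omegaBar_eq : omegaBar a h H = fun p =>
    wedge (theta1 a h p) (theta2 a h p) + wedge (theta4 a H p) (theta3 a H p) := by
  funext p
  refine alt2_ext fun X Y => ?_
  simp [omegaBar, omegaSigma, wedge_apply, theta1_apply, theta2_apply, dcoord_apply]
  ring

theorem isPlaneDistribution_vertical (hU : IsOpen U) :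
    IsPlaneDistribution (domain U) vertical := by
  refine fun p hp => ⟨domain U, isOpen_domain hU, hp, subset_rfl, fun _ => Pi.single 2 1,
    fun _ => Pi.single 3 1, contDiffOn_const, contDiffOn_const, fun q _ => ⟨?_, ?_⟩⟩
  · rw [LinearIndependent.pair_iff]
    intro s t hst
    have h2 := congrFun hst 2
    have h3 := congrFun hst 3
    simp at h2 h3
    exact ⟨h2, h3⟩
  · ext V
    rw [Submodule.mem_span_pair]
    constructor
    · rintro ⟨h0, h1⟩
      have h0 : V 0 = 0 := h0
      have h1 : V 1 = 0 := h1
      refine ⟨V 2, V 3, ?_⟩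
      ext i
      fin_cases i <;> simp [h0, h1]
    · rintro ⟨s, t, rfl⟩
      simp [vertical, dcoord_apply]

namespace IsSolution

/-- The (1,0)-forms are spanned by θ₁ + iθ₂ and θ₃ + iεθ₄. The first has differential in the ideal
they generate; the second does up to a multiple of θ₁ ∧ θ₂, which has type (1,1). Hence both signs
are integrable. -/
theorem isHermitian (hs : IsSolution a U h H) {ε : ℝ} (hε : ε ^ 2 = 1) :
    IsHermitian (domain U) (metric a h H) (frameEnd (coframe a h H) (blockEnd ε)) := by
  refine isHermitian_frameEnd (isOpen_domain hs.isOpen) hs.contDiffOn_coframe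
    (fun p hp => hs.coframe_isInvertible hp) hs.isRiemannianMetric (fun p _ X Y => metric_apply X Y)
    (blockEnd_blockEnd hε) (blockEnd_dotProduct hε) fun p hp X Y => ?_
  have hJ : ∀ X, coframe a h H p (frameEnd (coframe a h H) (blockEnd ε) p X)
      = blockEnd ε (coframe a h H p X) := coframe_frameEnd (hs.coframe_isInvertible hp)
  simp only [coframe_apply, blockEnd_apply] at hJ
  have j1 : ∀ X, theta1 a h p (frameEnd (coframe a h H) (blockEnd ε) p X) = -theta2 a h p X :=
    fun X => congrFun (hJ X) 0
  have j2 : ∀ X, theta2 a h p (frameEnd (coframe a h H) (blockEnd ε) p X) = theta1 a h p X :=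
    fun X => congrFun (hJ X) 1
  have j3 : ∀ X, theta3 a H p (frameEnd (coframe a h H) (blockEnd ε) p X)
      = -(ε * theta4 a H p X) := fun X => congrFun (hJ X) 2
  have j4 : ∀ X, theta4 a H p (frameEnd (coframe a h H) (blockEnd ε) p X) = ε * theta3 a H p X :=
    fun X => congrFun (hJ X) 3
  simp only [hs.extOne_coframe hp, hs.extOne_theta1 hp, hs.extOne_theta2 hp,
    hs.extOne_theta3_eq hp, hs.extOne_theta4_eq hp, j1, j2, j3, j4, blockEnd_apply]
  generalize frameEnd (coframe a h H) (blockEnd ε) p X = X'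
  generalize frameEnd (coframe a h H) (blockEnd ε) p Y = Y'
  ext i
  fin_cases i
  · simp
    ring
  · simp
    ring
  · simp
    linear_combination (2 * a) * (theta4 a H p X * formB a H p Y - theta4 a H p Y * formB a H p X)
      * hε
  · simp
    linear_combination (2 * a) * (theta3 a H p Y * formB a H p X - theta3 a H p X * formB a H p Y)
      * hε

theorem isKahlerForm (hs : IsSolution a U h H) :
    IsKahlerForm (domain U) (metric a h H) (frameEnd (coframe a h H) (blockEnd 1))
      (omega a h H) := by
  intro p hp X Y
  rw [metric_apply, coframe_frameEnd (hs.coframe_isInvertible hp), blockEnd_dotProduct_right,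
    omega_eq, coframe_apply, coframe_apply]
  simp [wedge_apply]
  ring

theorem isKahlerForm_bar (hs : IsSolution a U h H) :
    IsKahlerForm (domain U) (metric a h H) (frameEnd (coframe a h H) (blockEnd (-1)))
      (omegaBar a h H) := by
  intro p hp X Y
  rw [metric_apply, coframe_frameEnd (hs.coframe_isInvertible hp), blockEnd_dotProduct_right,
    omegaBar_eq, coframe_apply, coframe_apply]
  simp [wedge_apply]
  ring

theorem differentiableAt_omega (hs : IsSolution a U h H) (hp : p ∈ domain U) :
    DifferentiableAt ℝ (omega a h H) p := by
  rw [omega_eq]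
  exact (differentiableAt_wedge (hs.differentiableAt hp hs.contDiffOn_theta1)
    (hs.differentiableAt hp hs.contDiffOn_theta2)).fun_add
    (differentiableAt_wedge (hs.differentiableAt hp hs.contDiffOn_theta3)
    (hs.differentiableAt hp hs.contDiffOn_theta4))

/-- d(θ₁ ∧ θ₂) = 2a tanh az dz ∧ θ₁ ∧ θ₂ is cancelled by -θ₄ ∧ dθ₃, because Q ∧ θ₁ ∧ θ₂ = 0. For Ω
the two terms add up instead and produce the Lee form. -/
theorem isKahler_bar (hs : IsSolution a U h H) :
    IsKahler (domain U) (metric a h H) (frameEnd (coframe a h H) (blockEnd (-1))) := by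
  refine ⟨hs.isHermitian (by norm_num), _, hs.isKahlerForm_bar, fun p hp =>
    extDeriv_eq_zero_of_apply fun X Y Z => ?_⟩
  have h1 := hs.differentiableAt hp hs.contDiffOn_theta1
  have h2 := hs.differentiableAt hp hs.contDiffOn_theta2
  have h3 := hs.differentiableAt hp hs.contDiffOn_theta3
  have h4 := hs.differentiableAt hp hs.contDiffOn_theta4
  rw [omegaBar_eq, extDeriv_fun_add (differentiableAt_wedge h1 h2) (differentiableAt_wedge h4 h3),
    ContinuousAlternatingMap.add_apply, extDeriv_wedge h1 h2, extDeriv_wedge h4 h3]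
  simp only [hs.extOne_theta1 hp, hs.extOne_theta2 hp, hs.extOne_theta3_eq hp,
    hs.extOne_theta4_eq hp, dlogFactor_apply, theta1_apply, theta2_apply, theta4_apply,
    formQ_apply]
  ring

theorem contDiffOn_leeForm (hs : IsSolution a U h H) :
    ContDiffOn ℝ ∞ (fun p => -(alpha a p) • theta4 a H p) (domain U) := by
  have h1 : (fun p => -(alpha a p) • theta4 a H p)
      = fun p => ((2 : ℝ) * (a * Real.tanh (a * p 2))) • theta4 a H p := by
    funext p
    congr 1
    simp only [alpha]
    ring
  rw [h1]
  exact (contDiffOn_const.mul (contDiffOn_tanh _)).smul hs.contDiffOn_theta4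

theorem isLeeForm (hs : IsSolution a U h H) :
    IsLeeForm (domain U) (omega a h H) (fun p => -(alpha a p) • theta4 a H p) := by
  refine ⟨hs.contDiffOn_leeForm, fun p hp X Y Z => ?_⟩
  have h1 := hs.differentiableAt hp hs.contDiffOn_theta1
  have h2 := hs.differentiableAt hp hs.contDiffOn_theta2
  have h3 := hs.differentiableAt hp hs.contDiffOn_theta3
  have h4 := hs.differentiableAt hp hs.contDiffOn_theta4
  rw [omega_eq, extDeriv_fun_add (differentiableAt_wedge h1 h2) (differentiableAt_wedge h3 h4),
    ContinuousAlternatingMap.add_apply, extDeriv_wedge h1 h2, extDeriv_wedge h3 h4]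
  simp only [hs.extOne_theta1 hp, hs.extOne_theta2 hp, hs.extOne_theta3_eq hp,
    hs.extOne_theta4_eq hp, ContinuousAlternatingMap.add_apply, wedge_apply, smul_apply,
    smul_eq_mul, alpha, dlogFactor_apply, theta1_apply, theta2_apply, theta4_apply, formQ_apply]
  ring

theorem omega_nondegenerate (hs : IsSolution a U h H) (hp : p ∈ domain U) (η : R4 →L[ℝ] ℝ)
    (hη : ∀ X Y Z, η X * omega a h H p ![Y, Z] - η Y * omega a h H p ![X, Z]
      + η Z * omega a h H p ![X, Y] = 0) : η = 0 := by
  have hi := hs.coframe_isInvertible (p := p) hp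
  generalize hEdef : (fun i : Fin 4 => (coframe a h H p).inverse (Pi.single i 1)) = E at *
  have hE : ∀ i, coframe a h H p (E i) = Pi.single i 1 := fun i => by
    rw [← hEdef]
    exact hi.self_apply_inverse _
  have hΩ : ∀ i j, omega a h H p ![E i, E j]
      = blockEnd 1 (Pi.single i 1) ⬝ᵥ (Pi.single j 1 : R4) := fun i j => by
    rw [hs.isKahlerForm p hp, metric_apply, coframe_frameEnd hi, hE, hE]
  -- One index is paired with the complementary Ω-plane, so each triple isolates one coefficient of
  -- η.
  have h0 := hη (E 0) (E 2) (E 3)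
  have h1 := hη (E 1) (E 2) (E 3)
  have h2 := hη (E 2) (E 0) (E 1)
  have h3 := hη (E 3) (E 0) (E 1)
  simp [hΩ, blockEnd_apply] at h0 h1 h2 h3
  ext X
  have hX : X = ∑ i, coframe a h H p X i • E i := hi.injective (by
    simp only [map_sum, map_smul, hE]
    simpa using ((Pi.basisFun ℝ (Fin 4)).sum_repr (coframe a h H p X)).symm)
  rw [hX]
  simp [Fin.sum_univ_four, h0, h1, h2, h3]

theorem not_isLocallyConformallyKahler (hs : IsSolution a U h H) (hU : U.Nonempty) :
    ¬ IsLocallyConformallyKahler (domain U) (metric a h H)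
      (frameEnd (coframe a h H) (blockEnd 1)) := by
  intro hK
  obtain ⟨q, hq⟩ := hU
  -- On ∂/∂t, ∂/∂x the dz ∧ θ₄ part of dθ vanishes, leaving 2a tanh az dθ₄. At t = 0 this is -4a²
  -- tanh(az) H, nonzero for z = -1.
  set p : R4 := ![q.1, q.2, -1, 0] with hpdef
  have hp : p ∈ domain U := ⟨hq, by simp [hpdef]⟩
  have hd := hK.extOne_leeForm hs.isKahlerForm (fun p hp => hs.differentiableAt_omega hp)
    hs.isLeeForm (fun p hp => hs.omega_nondegenerate hp) hp (Pi.single 3 1) (Pi.single 0 1)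
  have hα : HasFDerivAt (fun p => -alpha a p)
      ((2 : ℝ) • (a ^ 2 / Real.cosh (a * p 2) ^ 2) • dcoord 2) p := by
    refine ((hasFDerivAt_tanh a 2 p).const_mul 2).congr_of_eventuallyEq
      (Filter.Eventually.of_forall fun q => ?_)
    simp only [alpha]
    ring
  rw [extOne_smul hα.differentiableAt (hs.differentiableAt hp hs.contDiffOn_theta4), hα.fderiv,
    hs.extOne_theta4 hp] at hd
  have hne := (hs.H_pos q hq).ne'
  simp [dcoord_apply, theta4_apply, formQ_apply, formP_apply, formA, hpdef, alpha,
    Real.tanh_eq_sinh_div_cosh, hs.ne_zero, hne, (Real.cosh_pos a).ne'] at hd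

theorem mem_vertical_iff (hs : IsSolution a U h H) (hp : p ∈ domain U) (V : R4) :
    V ∈ vertical p ↔ coframe a h H p V 0 = 0 ∧ coframe a h H p V 1 = 0 := by
  have hh := (hs.h_pos _ hp.1).ne'
  have hc := (Real.cosh_pos (a * p 2)).ne'
  rw [coframe_apply]
  simp [vertical, dcoord_apply, theta1_apply, theta2_apply, hh, hc]

end IsSolution

end Structures

end KahlerSurface

end

theorem theorem4 (a : ℝ) (ha : a ≠ 0)
    (U : Set (ℝ × ℝ)) (hU : IsOpen U) (hUne : U.Nonempty)
    (h H : ℝ × ℝ → ℝ)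
    (h_smooth : ContDiffOn ℝ ∞ h U) (h_pos : ∀ q ∈ U, 0 < h q)
    (H_smooth : ContDiffOn ℝ ∞ H U) (H_pos : ∀ q ∈ U, 0 < H q)
    (H_eq : ∀ q ∈ U, KahlerSurface.laplacian2 (fun r => Real.log (H r)) q
      = -2 * a ^ 2 * h q ^ 2 + 4 * a ^ 2 * H q ^ 2) :
    ∃ Jbar J : KahlerSurface.EndField,
      -- the Kähler structure and its Kähler form
      KahlerSurface.IsKahler (KahlerSurface.domain U) (KahlerSurface.metric a h H) Jbar ∧
      KahlerSurface.IsKahlerForm (KahlerSurface.domain U) (KahlerSurface.metric a h H) Jbar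
        (KahlerSurface.omegaBar a h H) ∧
      -- which is QCH
      KahlerSurface.IsQCH (KahlerSurface.domain U) (KahlerSurface.metric a h H) Jbar
        KahlerSurface.vertical ∧
      -- the opposite Hermitian structure and its Kähler form
      KahlerSurface.IsHermitian (KahlerSurface.domain U) (KahlerSurface.metric a h H) J ∧
      KahlerSurface.IsKahlerForm (KahlerSurface.domain U) (KahlerSurface.metric a h H) J
        (KahlerSurface.omega a h H) ∧
      KahlerSurface.IsOpposite (KahlerSurface.domain U) (KahlerSurface.metric a h H) Jbar J ∧
      -- its Ricci tensor is invariant, it is not locally conformally Kähler, and its Lee form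
      KahlerSurface.RicciInvariant (KahlerSurface.domain U) (KahlerSurface.metric a h H) J ∧
      ¬ KahlerSurface.IsLocallyConformallyKahler (KahlerSurface.domain U)
        (KahlerSurface.metric a h H) J ∧
      KahlerSurface.IsLeeForm (KahlerSurface.domain U) (KahlerSurface.omega a h H)
        (fun p => -(KahlerSurface.alpha a p) • KahlerSurface.theta4 a H p) := by
  have hs : KahlerSurface.IsSolution a U h H :=
    ⟨ha, hU, h_smooth, h_pos, H_smooth, H_pos, H_eq⟩
  have hinv : ∀ p ∈ KahlerSurface.domain U, (KahlerSurface.coframe a h H p).IsInvertible :=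
    fun p hp => hs.coframe_isInvertible hp
  have hg : ∀ p ∈ KahlerSurface.domain U, ∀ X Y, KahlerSurface.metric a h H p X Y
      = KahlerSurface.coframe a h H p X ⬝ᵥ KahlerSurface.coframe a h H p Y :=
    fun p _ X Y => KahlerSurface.metric_apply X Y
  exact ⟨_, _, hs.isKahler_bar, hs.isKahlerForm_bar,
    KahlerSurface.isQCH_of_curvatureModel hinv hg (fun p hp => hs.coframe_riemann hp)
      (KahlerSurface.isPlaneDistribution_vertical hU)
      (fun p hp => hs.mem_vertical_iff hp) hs.isKahler_bar,
    hs.isHermitian (by norm_num), hs.isKahlerForm,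
    KahlerSurface.isOpposite_frameEnd hinv hg,
    KahlerSurface.ricciInvariant_of_curvatureModel hinv (fun p hp => hs.coframe_riemann hp),
    hs.not_isLocallyConformallyKahler hUne, hs.isLeeForm⟩
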